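/- A finite set $S\subset\mathbb{R}^2$ is in general position if no three of its points are collinear. For such an $S$ with $n=|S|$ even, a halving line is a line through two points of $S$ having equally many of the remaining $n-2$ points on each side. The underlying graph of $S$ has vertex set $S$, two points being adjacent iff the line through them is a halving line. (a) For every even $n$ there is a set of $n$ points in general position in the plane whose underlying graph contains a clique with at least $\sqrt{n/2}$ vertices. (b) For every even $k\ge 4$ there are a set $P=\{p_0,\dots,p_{k-1}\}$ and a set $Q$ of $2k^2-6k$ further points, with $P\cup Q$ in general position, such that the following hold. - $P$ is a projectively distorted regular $k$-gon: $p_i$ is the image of the $i$-th vertex (in cyclic order) of a regular $k$-gon under an invertible projective transformation that sends no point of the closed polygon to infinity and under which no line $p_ip_j$ is parallel to the horizon (the image of the line at infinity). - Every side and every diagonal $p_ip_j$ ($i\ne j$) is a halving line of $P\cup Q$, so the $k$ points of $P$ form a clique in the underlying graph on these $2k^2-5k$ points. - $Q$ is a disjoint union of clusters $Q_c$, $c\in\mathbb{Z}/k$, one for each class of lines $p_ip_j$ with $i+j\equiv c \pmod k$ (the images of a class of parallel sides and diagonals of the regular $k$-gon), where $|Q_c|=2k-4$ if $c$ is odd and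 $|Q_c|=2k-8$ if $c$ is even. Each line of class $c$ has equally many points of $P\cup Q_c$ on its two sides, and each line $p_ip_j$ not of class $c$ has equally many points of $Q_c$ on its two sides. -/

import Mathlib

namespace HalvingLines

/-- Twice the signed area of the triangle `p q r`: positive if `r` lies strictly to the left of the
line directed from `p` to `q`, negative if strictly to the right, zero if on the line. -/
def orient (p q r : ℝ × ℝ) : ℝ :=
  (q.1 - p.1) * (r.2 - p.2) - (q.2 - p.2) * (r.1 - p.1)

/-- No three distinct points of `S` are collinear. -/
def GeneralPosition (S : Finset (ℝ × ℝ)) : Prop :=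
  ∀ p ∈ S, ∀ q ∈ S, ∀ r ∈ S, p ≠ q → p ≠ r → q ≠ r → ¬ Collinear ℝ {p, q, r}

open Classical in
/-- The points of `S` strictly to the left of the line directed from `p` to `q`. -/
noncomputable def leftOf (S : Finset (ℝ × ℝ)) (p q : ℝ × ℝ) : Finset (ℝ × ℝ) :=
  S.filter fun r => 0 < orient p q r

open Classical in
/-- The points of `S` strictly to the right of the line directed from `p` to `q`. -/
noncomputable def rightOf (S : Finset (ℝ × ℝ)) (p q : ℝ × ℝ) : Finset (ℝ × ℝ) :=
  S.filter fun r => orient p q r < 0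

/-- The line through `p` and `q` has as many points of `S` strictly on one side as on the other. -/
def Bisects (S : Finset (ℝ × ℝ)) (p q : ℝ × ℝ) : Prop :=
  (leftOf S p q).card = (rightOf S p q).card

/-- The line through the two distinct points `p`, `q` of `S` is a halving line of `S`. -/
def IsHalvingLine (S : Finset (ℝ × ℝ)) (p q : ℝ × ℝ) : Prop :=
  p ∈ S ∧ q ∈ S ∧ p ≠ q ∧ Bisects S p q

theorem orient_swap (p q r : ℝ × ℝ) : orient q p r = - orient p q r := by
  unfold orient; ring

theorem Bisects.symm {S : Finset (ℝ × ℝ)} {p q : ℝ × ℝ} (h : Bisects S p q) :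
    Bisects S q p := by
  unfold Bisects leftOf rightOf at *
  simp only [orient_swap p q, Left.neg_pos_iff, Left.neg_neg_iff]
  exact h.symm

/-- The underlying graph of `S`: its vertices are the points of `S`, and two of them are adjacent
iff the line through them is a halving line of `S`. -/
def underlyingGraph (S : Finset (ℝ × ℝ)) : SimpleGraph S where
  Adj p q := IsHalvingLine S p q
  symm := ⟨fun _ _ h => ⟨h.2.1, h.1, h.2.2.1.symm, h.2.2.2.symm⟩⟩
  loopless := ⟨fun _ h => h.2.2.1 rfl⟩

/-- The `i`-th vertex of the regular `k`-gon inscribed in the unit circle. -/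
noncomputable def polygonVertex (k : ℕ) (i : Fin k) : ℝ × ℝ :=
  (Real.cos (2 * Real.pi * (i : ℕ) / k), Real.sin (2 * Real.pi * (i : ℕ) / k))

/-- Homogeneous coordinates of the image of the point `p` under the projective transformation with
matrix `M`. -/
def homImage (M : Matrix (Fin 3) (Fin 3) ℝ) (p : ℝ × ℝ) : Fin 3 → ℝ :=
  M.mulVec ![p.1, p.2, 1]

/-- The image in the affine plane of `p` under the projective transformation with matrix `M`
(used only where the last homogeneous coordinate is positive). -/
noncomputable def projImage (M : Matrix (Fin 3) (Fin 3) ℝ) (p : ℝ × ℝ) : ℝ × ℝ :=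
  (homImage M p 0 / homImage M p 2, homImage M p 1 / homImage M p 2)

/-- `P` lists the vertices of a projectively distorted regular `k`-gon: the image of the regular
`k`-gon under a projective transformation which sends no point of the (closed, filled) polygon to
infinity, and for which no chord of the image is parallel to the horizon (the image of the line at
infinity). The last homogeneous coordinate is affine in the point, so its positivity at the vertices
gives positivity on the polygon; and the image of a chord is parallel to the horizon exactly if this
coordinate agrees at its two endpoints. -/
def IsDistortedRegularPolygon (k : ℕ) (P : Fin k → ℝ × ℝ) : Prop :=
  ∃ M : Matrix (Fin 3) (Fin 3) ℝ, M.det ≠ 0 ∧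
    (∀ i, 0 < homImage M (polygonVertex k i) 2) ∧
    (∀ i j, i ≠ j → homImage M (polygonVertex k i) 2 ≠ homImage M (polygonVertex k j) 2) ∧
    ∀ i, P i = projImage M (polygonVertex k i)

open Classical in
/-- The set of vertices listed by `P`. -/
noncomputable def vertexSet {k : ℕ} (P : Fin k → ℝ × ℝ) : Finset (ℝ × ℝ) :=
  Finset.univ.image P

open Classical in
/-- The union of the clusters `Q c`. -/
noncomputable def addedPoints {k : ℕ} (Q : Fin k → Finset (ℝ × ℝ)) : Finset (ℝ × ℝ) :=
  Finset.univ.biUnion Q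

/-- Sides and diagonals `ij` of the regular `k`-gon fall into `k` classes of parallel lines
according to `i + j` modulo `k`; the line `ij` belongs to class `c`. -/
def InClass {k : ℕ} (c i j : Fin k) : Prop :=
  ((i : ℕ) + (j : ℕ)) % k = (c : ℕ)

end HalvingLines

namespace HalvingLines

/-! A projective map turns each class of parallel chords of the regular `k`-gon into a pencil of
lines through one point of the horizon. For `i < j` the chord has `k - 2 * (j - i)` more vertices on
its left than on its right, so with consistent orientation neighbouring chords of a class differ by
4. Two extra points in each gap of the pencil make up this difference. They must lie beyond the
horizon, where the sides of the pencil are interchanged: a short chord then has most of them on its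
side with fewer vertices (`exists_point_beyond`).

Close to the centre of its pencil an extra point lies on a known side of every chord outside the
class. An equal number of points on the opposite side of all those chords cancels this effect; half
of them go on either side of the whole class, so they do not disturb it (`exists_point_opposite`).
Hence the classes can be balanced independently. For even `k` the balance is exact
(`sum_cluster_even`). For odd `k` an error of ±1 remains, depending on the parity of `i + j`
(`sum_cluster_odd`); it is removed by `k` distant points in suitable directions (`exists_point_far`,
`sum_far`).

All requirements are strict sign conditions, hence open, so general position is obtained by moving
the extra points slightly (`exists_generic_perturbation`).

For the clique bound, the configurations have `2k² - 5k` points (`k` even) or `2k² - 4k` points (`k`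
odd), in both cases at most `2(k - 1)²`. Pairs of far points in opposite directions fill up to any
larger even `n` (`HasHalvingClique.add_two`), and the least `k ≥ 2` with `n ≤ 2k²` is used. -/

/-! ### Orientation, collinearity and general position -/

theorem collinear_iff_orient_eq_zero (p q r : ℝ × ℝ) :
    Collinear ℝ {p, q, r} ↔ orient p q r = 0 := by
  rw [collinear_iff_of_mem (p₀ := p) (by simp)]
  constructor
  · rintro ⟨v, hv⟩
    obtain ⟨a, ha⟩ := hv q (by simp)
    obtain ⟨b, hb⟩ := hv r (by simp)
    simp only [ha, hb, orient, vadd_eq_add, Prod.fst_add, Prod.snd_add, Prod.smul_fst,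
      Prod.smul_snd, smul_eq_mul]
    ring
  · intro h
    by_cases hpq : p = q
    · refine ⟨r - p, ?_⟩
      subst hpq
      simp only [Set.mem_insert_iff, Set.mem_singleton_iff]
      rintro x (rfl | rfl | rfl)
      · exact ⟨0, by simp⟩
      · exact ⟨0, by simp⟩
      · exact ⟨1, by simp⟩
    · refine ⟨q - p, ?_⟩
      simp only [Set.mem_insert_iff, Set.mem_singleton_iff]
      rintro x (rfl | rfl | rfl)
      · exact ⟨0, by simp⟩
      · exact ⟨1, by simp⟩
      · have hne : q.1 - p.1 ≠ 0 ∨ q.2 - p.2 ≠ 0 := by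
          by_contra! hc
          exact hpq (Prod.ext (by linarith [hc.1]) (by linarith [hc.2]))
        unfold orient at h
        rcases hne with h1 | h1
        · refine ⟨(x.1 - p.1) / (q.1 - p.1), Prod.ext ?_ ?_⟩
          · simp; field_simp; ring
          · simp; field_simp; linarith
        · refine ⟨(x.2 - p.2) / (q.2 - p.2), Prod.ext ?_ ?_⟩
          · simp; field_simp; linarith
          · simp; field_simp; ring

theorem orient_rotate (p q r : ℝ × ℝ) : orient q r p = orient p q r := by
  unfold orient; ring

theorem generalPosition_iff (S : Finset (ℝ × ℝ)) : GeneralPosition S ↔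
    ∀ p ∈ S, ∀ q ∈ S, ∀ r ∈ S, p ≠ q → p ≠ r → q ≠ r → orient p q r ≠ 0 := by
  simp only [GeneralPosition, collinear_iff_orient_eq_zero]

theorem GeneralPosition.mono {S T : Finset (ℝ × ℝ)} (h : GeneralPosition T) (hST : S ⊆ T) :
    GeneralPosition S :=
  fun p hp q hq r hr => h p (hST hp) q (hST hq) r (hST hr)

theorem continuous_orient (p q : ℝ × ℝ) : Continuous (orient p q) := by
  unfold orient; fun_prop

/-- Moving `r` perpendicularly to `p q` changes the orientation at the constant nonzero rate `|q -
p|²`, so arbitrarily small moves leave the line. -/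
theorem dense_orient_ne_zero {p q : ℝ × ℝ} (h : p ≠ q) : Dense {r | orient p q r ≠ 0} := by
  intro r
  set D := (q.1 - p.1) ^ 2 + (q.2 - p.2) ^ 2 with hD
  have hD0 : D ≠ 0 := by
    intro h0
    have h1 : q.1 - p.1 = 0 := by nlinarith [sq_nonneg (q.1 - p.1), sq_nonneg (q.2 - p.2)]
    have h2 : q.2 - p.2 = 0 := by nlinarith [sq_nonneg (q.1 - p.1), sq_nonneg (q.2 - p.2)]
    exact h (Prod.ext (by linarith) (by linarith))
  let f : ℝ → ℝ × ℝ := fun t => (r.1 - t * (q.2 - p.2), r.2 + t * (q.1 - p.1))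
  have hf : ∀ t, orient p q (f t) = orient p q r + t * D := by
    intro t; simp only [orient, f, hD]; ring
  have hcont : Continuous f := by fun_prop
  have hlim : Filter.Tendsto f (nhdsWithin 0 {0}ᶜ) (nhds r) := by
    have h1 := hcont.tendsto 0
    have h2 : f 0 = r := by simp [f]
    rw [h2] at h1
    exact h1.mono_left nhdsWithin_le_nhds
  refine mem_closure_of_tendsto hlim ?_
  have hev : ∀ᶠ t in nhdsWithin (0 : ℝ) {0}ᶜ, t ≠ -orient p q r / D := by
    by_cases h0 : -orient p q r / D = 0
    · rw [h0]; exact self_mem_nhdsWithin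
    · exact nhdsWithin_le_nhds (isOpen_ne.mem_nhds (Ne.symm h0))
  filter_upwards [hev] with t ht
  simp only [hf]
  intro h0
  exact ht (by field_simp; linarith)

open Classical in
-- The lines spanned by `T` and the points of `T` have dense open complements; finitely many of
-- these meet inside `U`.
theorem exists_insert_generalPosition {T : Finset (ℝ × ℝ)} (hT : GeneralPosition T)
    {U : Set (ℝ × ℝ)} (hU : IsOpen U) (hne : U.Nonempty) :
    ∃ p ∈ U, p ∉ T ∧ GeneralPosition (insert p T) := by
  have h1 : Dense (⋂ x ∈ (T.offDiag : Set ((ℝ × ℝ) × (ℝ × ℝ))), {r | orient x.1 x.2 r ≠ 0}) :=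
    dense_biInter_of_isOpen (fun x _ => isOpen_ne_fun (continuous_orient _ _) continuous_const)
      (Finset.countable_toSet _) fun x hx =>
        dense_orient_ne_zero (Finset.mem_offDiag.1 (Finset.mem_coe.1 hx)).2.2
  have h2 : Dense (⋂ x ∈ (T : Set (ℝ × ℝ)), ({x}ᶜ : Set (ℝ × ℝ))) :=
    dense_biInter_of_isOpen (fun x _ => isOpen_compl_singleton)
      (Finset.countable_toSet _) (fun x _ => dense_compl_singleton x)
  have h2o : IsOpen (⋂ x ∈ (T : Set (ℝ × ℝ)), ({x}ᶜ : Set (ℝ × ℝ))) :=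
    T.finite_toSet.isOpen_biInter (fun x _ => isOpen_compl_singleton)
  obtain ⟨p, hpU, hp1, hp2⟩ := (h1.inter_of_isOpen_right h2 h2o).inter_open_nonempty U hU hne
  simp only [Set.mem_iInter, Finset.mem_coe, Finset.mem_offDiag, Set.mem_ofPred_eq,
    Set.mem_compl_iff, Set.mem_singleton_iff] at hp1 hp2
  refine ⟨p, hpU, fun h => hp2 p h rfl, ?_⟩
  rw [generalPosition_iff] at hT ⊢
  have key : ∀ q ∈ T, ∀ r ∈ T, q ≠ r → orient q r p ≠ 0 :=
    fun q hq r hr hqr => hp1 (q, r) ⟨hq, hr, hqr⟩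
  intro a ha b hb c hc hab hac hbc
  rw [Finset.mem_insert] at ha hb hc
  rcases ha with rfl | ha
  · rw [← orient_rotate]
    exact key b (hb.resolve_left (Ne.symm hab)) c (hc.resolve_left (Ne.symm hac)) hbc
  rcases hb with rfl | hb
  · rw [← orient_rotate, ← orient_rotate]
    exact key c (hc.resolve_left (Ne.symm hbc)) a ha (Ne.symm hac)
  rcases hc with rfl | hc
  · exact key a ha b hb hab
  · exact hT a ha b hb c hc hab hac hbc

open Classical in
/-- Finitely many points may be chosen in prescribed open sets so that they extend a given set in
general position to a larger one. -/
theorem exists_generic_points {ι : Type*} [Fintype ι] {S : Finset (ℝ × ℝ)}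
    (hS : GeneralPosition S) {U : ι → Set (ℝ × ℝ)} (hU : ∀ i, IsOpen (U i))
    (hne : ∀ i, (U i).Nonempty) :
    ∃ z : ι → ℝ × ℝ, Function.Injective z ∧ (∀ i, z i ∈ U i) ∧ (∀ i, z i ∉ S) ∧
      GeneralPosition (S ∪ Finset.univ.image z) := by
  suffices H : ∀ s : Finset ι, ∃ z : ι → ℝ × ℝ, Set.InjOn z s ∧ (∀ i ∈ s, z i ∈ U i) ∧
      (∀ i ∈ s, z i ∉ S) ∧ GeneralPosition (S ∪ s.image z) by
    obtain ⟨z, h1, h2, h3, h4⟩ := H Finset.univ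
    exact ⟨z, by simpa [Set.injOn_univ] using h1, fun i => h2 i (by simp),
      fun i => h3 i (by simp), h4⟩
  intro s
  induction s using Finset.induction_on with
  | empty => exact ⟨fun _ => 0, by simp, by simp, by simp, by simpa using hS⟩
  | insert a s ha ih =>
    obtain ⟨z, h1, h2, h3, h4⟩ := ih
    obtain ⟨p, hpU, hp, hgp⟩ := exists_insert_generalPosition h4 (hU a) (hne a)
    have hz : ∀ i ∈ s, Function.update z a p i = z i := fun i hi =>
      Function.update_of_ne (by rintro rfl; exact ha hi) _ _
    have him : s.image (Function.update z a p) = s.image z := Finset.image_congr hz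
    rw [Finset.mem_union, Finset.mem_image] at hp
    push Not at hp
    refine ⟨Function.update z a p, ?_, ?_, ?_, ?_⟩
    · rw [Finset.coe_insert, Set.injOn_insert (by simpa using ha)]
      refine ⟨h1.congr fun i hi => (hz i hi).symm, ?_⟩
      rintro ⟨i, hi, hip⟩
      rw [hz i hi, Function.update_self] at hip
      exact hp.2 i hi hip
    · intro i hi
      rcases Finset.mem_insert.1 hi with rfl | hi
      · rwa [Function.update_self]
      · rw [hz i hi]; exact h2 i hi
    · intro i hi
      rcases Finset.mem_insert.1 hi with rfl | hi
      · rw [Function.update_self]; exact hp.1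
      · rw [hz i hi]; exact h3 i hi
    · rw [Finset.image_insert, Function.update_self, him, Finset.union_insert]
      exact hgp

/-! ### Signed counts and perturbation -/

/-- The number of points of `S` to the left of the line `p q` minus the number to the right. -/
noncomputable def signSum (S : Finset (ℝ × ℝ)) (p q : ℝ × ℝ) : ℤ :=
  ∑ r ∈ S, (SignType.sign (orient p q r) : ℤ)

theorem bisects_iff_signSum (S : Finset (ℝ × ℝ)) (p q : ℝ × ℝ) :
    Bisects S p q ↔ signSum S p q = 0 := by
  classical
  have h : signSum S p q = (leftOf S p q).card - (rightOf S p q).card := by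
    unfold signSum leftOf rightOf
    rw [Finset.card_filter, Finset.card_filter]
    push_cast
    rw [← Finset.sum_sub_distrib]
    refine Finset.sum_congr rfl fun r _ => ?_
    rcases lt_trichotomy (orient p q r) 0 with h | h | h
    · simp [h, not_lt.2 h.le]
    · simp [h]
    · simp [h, not_lt.2 h.le]
  rw [h, sub_eq_zero, Nat.cast_inj, Bisects]

open Classical in
theorem signSum_union {S T : Finset (ℝ × ℝ)} (h : Disjoint S T) (p q : ℝ × ℝ) :
    signSum (S ∪ T) p q = signSum S p q + signSum T p q :=
  Finset.sum_union h

open Classical in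
theorem signSum_image {ι : Type*} {s : Finset ι} {z : ι → ℝ × ℝ} (hz : Function.Injective z)
    (p q : ℝ × ℝ) :
    signSum (s.image z) p q = ∑ i ∈ s, (SignType.sign (orient p q (z i)) : ℤ) :=
  Finset.sum_image fun _ _ _ _ h => hz h

theorem isOpen_sign_eq {f : ℝ × ℝ → ℝ} (hf : Continuous f) {x : ℝ × ℝ} (hx : f x ≠ 0) :
    ∃ U, IsOpen U ∧ x ∈ U ∧ ∀ y ∈ U, SignType.sign (f y) = SignType.sign (f x) := by
  rcases lt_or_gt_of_ne hx with h | h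
  · exact ⟨{y | f y < 0}, isOpen_lt hf continuous_const, h, fun y hy => by
      rw [sign_neg h, sign_neg hy]⟩
  · exact ⟨{y | 0 < f y}, isOpen_lt continuous_const hf, h, fun y hy => by
      rw [sign_pos h, sign_pos hy]⟩

open Classical in
/-- Points can be perturbed into general position without crossing any of finitely many lines. -/
theorem exists_generic_perturbation {ι : Type*} [Fintype ι] {S : Finset (ℝ × ℝ)}
    (hS : GeneralPosition S) (A : Finset ((ℝ × ℝ) × (ℝ × ℝ))) (z₀ : ι → ℝ × ℝ)
    (hz₀ : ∀ i, ∀ x ∈ A, orient x.1 x.2 (z₀ i) ≠ 0) :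
    ∃ z : ι → ℝ × ℝ, Function.Injective z ∧ (∀ i, z i ∉ S) ∧
      GeneralPosition (S ∪ Finset.univ.image z) ∧
      ∀ i, ∀ x ∈ A, SignType.sign (orient x.1 x.2 (z i)) =
        SignType.sign (orient x.1 x.2 (z₀ i)) := by
  have h1 : ∀ i, ∃ U, IsOpen U ∧ z₀ i ∈ U ∧ ∀ y ∈ U, ∀ x ∈ A,
      SignType.sign (orient x.1 x.2 y) = SignType.sign (orient x.1 x.2 (z₀ i)) := by
    intro i
    have h2 : ∀ x, ∃ U, IsOpen U ∧ z₀ i ∈ U ∧ (x ∈ A → ∀ y ∈ U,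
        SignType.sign (orient x.1 x.2 y) = SignType.sign (orient x.1 x.2 (z₀ i))) := by
      intro x
      by_cases hx : x ∈ A
      · obtain ⟨U, ho, hm, h⟩ := isOpen_sign_eq (continuous_orient x.1 x.2) (hz₀ i x hx)
        exact ⟨U, ho, hm, fun _ => h⟩
      · exact ⟨Set.univ, isOpen_univ, trivial, fun h => absurd h hx⟩
    choose U ho hm h using h2
    refine ⟨⋂ x ∈ A, U x, isOpen_biInter_finset fun x _ => ho x,
      Set.mem_iInter₂.2 fun x _ => hm x, fun y hy x hx => h x hx y ?_⟩
    exact Set.mem_iInter₂.1 hy x hx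
  choose U ho hm h using h1
  obtain ⟨z, h1, h2, h3, h4⟩ := exists_generic_points hS ho fun i => ⟨_, hm i⟩
  exact ⟨z, h1, h3, h4, fun i x hx => h i _ (h2 i) x hx⟩

/-! ### Padding by pairs of far points -/

/-- There are `n` points in general position, `m` of which are pairwise joined by lines having
equally many of the points on both sides. -/
def HasHalvingClique (n m : ℕ) : Prop :=
  ∃ S K : Finset (ℝ × ℝ), K ⊆ S ∧ S.card = n ∧ K.card = m ∧ GeneralPosition S ∧
    ∀ p ∈ K, ∀ q ∈ K, p ≠ q → Bisects S p q

/-- The direction `(1, y)` is to be parallel to no line spanned by `S`; only finitely many slopes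
are excluded. -/
theorem exists_transversal_direction (S : Finset (ℝ × ℝ)) :
    ∃ y : ℝ, ∀ p ∈ S, ∀ q ∈ S, p ≠ q → (q.1 - p.1) * y - (q.2 - p.2) ≠ 0 := by
  classical
  obtain ⟨y, hy⟩ := Infinite.exists_notMem_finset
    ((S ×ˢ S).image fun x => (x.2.2 - x.1.2) / (x.2.1 - x.1.1))
  refine ⟨y, fun p hp q hq hpq h => ?_⟩
  by_cases h1 : q.1 - p.1 = 0
  · rw [h1] at h
    exact hpq (Prod.ext (by linarith) (by linarith))
  · refine hy (Finset.mem_image.2 ⟨(p, q), Finset.mem_product.2 ⟨hp, hq⟩, ?_⟩)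
    field_simp
    linarith

theorem eventually_sign_add_mul (a : ℝ) {b : ℝ} (hb : b ≠ 0) :
    ∀ᶠ R in Filter.atTop, SignType.sign (a + R * b) = SignType.sign b := by
  rcases lt_or_gt_of_ne hb with h | h
  · filter_upwards [Filter.eventually_gt_atTop (a / -b)] with R hR
    rw [sign_neg h, sign_neg]
    rw [div_lt_iff₀ (by linarith)] at hR
    linarith
  · filter_upwards [Filter.eventually_gt_atTop (-a / b)] with R hR
    rw [sign_pos h, sign_pos]
    rw [div_lt_iff₀ h] at hR
    linarith

/-- Two points far out in opposite directions along a line of slope `y`, parallel to no line spanned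
by `S`, are separated by every such line. They add zero to each signed count, and this survives a
perturbation into general position. -/
theorem HasHalvingClique.add_two {n m : ℕ} (h : HasHalvingClique n m) :
    HasHalvingClique (n + 2) m := by
  classical
  obtain ⟨S, K, hKS, hn, hm, hgp, hb⟩ := h
  obtain ⟨y, hy⟩ := exists_transversal_direction S
  have hev : ∀ᶠ R : ℝ in Filter.atTop, ∀ x ∈ S.offDiag,
      SignType.sign (orient x.1 x.2 (R, R * y)) =
        SignType.sign ((x.2.1 - x.1.1) * y - (x.2.2 - x.1.2)) ∧
      SignType.sign (orient x.1 x.2 (-R, -R * y)) =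
        -SignType.sign ((x.2.1 - x.1.1) * y - (x.2.2 - x.1.2)) := by
    rw [Filter.eventually_all_finset]
    intro x hx
    obtain ⟨h1, h2, h3⟩ := Finset.mem_offDiag.1 hx
    have hne := hy _ h1 _ h2 h3
    filter_upwards [eventually_sign_add_mul (orient x.1 x.2 0) hne,
      eventually_sign_add_mul (orient x.1 x.2 0) (neg_ne_zero.2 hne)] with R hR1 hR2
    rw [Left.sign_neg] at hR2
    rw [← hR2, ← hR1]
    constructor <;> congr 1 <;> simp only [orient, Prod.fst_zero, Prod.snd_zero] <;> ring
  obtain ⟨R, hR⟩ := hev.exists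
  have hne : ∀ x ∈ S.offDiag,
      SignType.sign ((x.2.1 - x.1.1) * y - (x.2.2 - x.1.2)) ≠ 0 := fun x hx => by
    obtain ⟨h1, h2, h3⟩ := Finset.mem_offDiag.1 hx
    exact sign_ne_zero.2 (hy _ h1 _ h2 h3)
  obtain ⟨z, hinj, hzS, hgp', hsign⟩ := exists_generic_perturbation hgp S.offDiag
    (fun b : Bool => if b then (R, R * y) else (-R, -R * y)) (by
      intro b x hx
      rw [← sign_ne_zero]
      cases b
      · simp only [Bool.false_eq_true, if_false, (hR x hx).2]
        have h := hne x hx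
        revert h
        generalize SignType.sign ((x.2.1 - x.1.1) * y - (x.2.2 - x.1.2)) = s
        revert s
        decide
      · simp only [if_true, (hR x hx).1]
        exact hne x hx)
  have hdisj : Disjoint S (Finset.univ.image z) := by
    rw [Finset.disjoint_right]
    intro p hp
    obtain ⟨b, -, rfl⟩ := Finset.mem_image.1 hp
    exact hzS b
  refine ⟨S ∪ Finset.univ.image z, K, hKS.trans Finset.subset_union_left, ?_, hm, hgp', ?_⟩
  · rw [Finset.card_union_of_disjoint hdisj, hn, Finset.card_image_of_injective _ hinj]
    rfl
  · intro p hp q hq hpq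
    have hx : (p, q) ∈ S.offDiag := Finset.mem_offDiag.2 ⟨hKS hp, hKS hq, hpq⟩
    have h0 := (bisects_iff_signSum _ _ _).1 (hb p hp q hq hpq)
    rw [bisects_iff_signSum, signSum_union hdisj, h0, signSum_image hinj]
    have h1 := hsign true _ hx
    have h2 := hsign false _ hx
    simp only [if_true, Bool.false_eq_true, if_false] at h1 h2
    rw [(hR _ hx).1] at h1
    rw [(hR _ hx).2] at h2
    simp only [Fintype.sum_bool, h1, h2]
    cases SignType.sign ((q.1 - p.1) * y - (q.2 - p.2)) <;> decide

theorem HasHalvingClique.add_two_mul {n m : ℕ} (h : HasHalvingClique n m) (a : ℕ) :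
    HasHalvingClique (n + 2 * a) m := by
  induction a with
  | zero => exact h
  | succ a ih => exact ih.add_two

/-! ### Signs and lower bounds for trigonometric values -/

theorem sign_sin_pi_mul_div {k : ℕ} {m : ℤ} (h : |m| < k) :
    SignType.sign (Real.sin (Real.pi * m / k)) = SignType.sign m := by
  have hpi := Real.pi_pos
  obtain ⟨h1, h2⟩ := abs_lt.1 h
  have hk : (0 : ℝ) < k := by
    have := (abs_nonneg m).trans_lt h
    exact_mod_cast this
  have h1' : -(k : ℝ) < m := by exact_mod_cast h1
  have h2' : (m : ℝ) < k := by exact_mod_cast h2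
  rcases lt_trichotomy m 0 with hm | rfl | hm
  · have hm' : (m : ℝ) < 0 := by exact_mod_cast hm
    rw [sign_neg hm, sign_neg]
    apply Real.sin_neg_of_neg_of_neg_pi_lt
    · exact div_neg_of_neg_of_pos (mul_neg_of_pos_of_neg hpi hm') hk
    · rw [lt_div_iff₀ hk]; nlinarith
  · simp
  · have hm' : (0 : ℝ) < m := by exact_mod_cast hm
    rw [sign_pos hm, sign_pos]
    apply Real.sin_pos_of_pos_of_lt_pi
    · positivity
    · rw [div_lt_iff₀ hk]; nlinarith

/-- Modulo π the angle lies between `π / n` and `π - π / n`, where the sine is least at the ends. -/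
theorem sin_pi_div_le_abs_sin {n : ℕ} (hn : 2 ≤ n) {m : ℤ} (h : ¬ (n : ℤ) ∣ m) :
    Real.sin (Real.pi / n) ≤ |Real.sin (Real.pi * m / n)| := by
  have hpi := Real.pi_pos
  have hn0 : (0 : ℝ) < n := by positivity
  have hn2 : (2 : ℝ) ≤ n := by exact_mod_cast hn
  have hr0 : 0 ≤ m % n := Int.emod_nonneg _ (by omega)
  have hrn : m % n < n := Int.emod_lt_of_pos _ (by omega)
  have hr1 : m % n ≠ 0 := fun h0 => h (Int.dvd_of_emod_eq_zero h0)
  have hm : (m : ℝ) = (m % n : ℤ) + n * (m / n : ℤ) := by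
    exact_mod_cast (Int.emod_add_mul_ediv m n).symm
  generalize m % n = r at *
  have hr1' : (1 : ℝ) ≤ r := by exact_mod_cast (by omega : 1 ≤ r)
  have hrn' : (r : ℝ) ≤ n - 1 := by
    have : r ≤ n - 1 := by omega
    exact_mod_cast this
  have hang : Real.pi * m / n = Real.pi * r / n + (m / n : ℤ) * Real.pi := by
    rw [hm]; field_simp
  rw [hang, Real.sin_add_int_mul_pi, abs_mul, abs_zpow, abs_neg, abs_one, one_zpow, one_mul]
  refine le_trans ?_ (le_abs_self _)
  have hb : Real.pi / n ≤ Real.pi * r / n := by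
    rw [div_le_div_iff_of_pos_right hn0]; nlinarith
  have hb0 : 0 < Real.pi / n := by positivity
  by_cases hcase : Real.pi * r / n ≤ Real.pi / 2
  · exact Real.sin_le_sin_of_le_of_le_pi_div_two (by linarith) hcase hb
  · rw [← Real.sin_pi_sub (Real.pi * r / n)]
    refine Real.sin_le_sin_of_le_of_le_pi_div_two (by linarith) (by linarith) ?_
    rw [le_sub_iff_add_le, ← add_div, div_le_iff₀ hn0]
    nlinarith

theorem sign_cos_sub_cos {k : ℕ} {d e : ℤ} (hd : 0 ≤ d) (hdk : d ≤ k) (he : 0 ≤ e)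
    (hek : e ≤ k) :
    SignType.sign (Real.cos (Real.pi * e / k) - Real.cos (Real.pi * d / k)) =
      SignType.sign (d - e) := by
  have hpi := Real.pi_pos
  rcases Nat.eq_zero_or_pos k with rfl | hk
  · have h1 : d = 0 := by simp at hdk; omega
    have h2 : e = 0 := by simp at hek; omega
    simp [h1, h2]
  have hk0 : (0 : ℝ) < k := by exact_mod_cast hk
  have key : ∀ a b : ℤ, 0 ≤ a → b ≤ k → a < b →
      Real.cos (Real.pi * b / k) < Real.cos (Real.pi * a / k) := by
    intro a b ha hb hab
    have ha' : (0 : ℝ) ≤ a := by exact_mod_cast ha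
    have hb' : (b : ℝ) ≤ k := by exact_mod_cast hb
    have hab' : (a : ℝ) < b := by exact_mod_cast hab
    apply Real.cos_lt_cos_of_nonneg_of_le_pi
    · positivity
    · rw [div_le_iff₀ hk0]; nlinarith
    · rw [div_lt_div_iff_of_pos_right hk0]; nlinarith
  rcases lt_trichotomy d e with h | rfl | h
  · rw [sign_neg (by have := key d e hd hek h; linarith), sign_neg (by omega)]
  · simp
  · rw [sign_pos (by have := key e d he hdk h; linarith), sign_pos (by omega)]

/-! ### The projective distortion and its chords -/

/-- The matrix of a projective transformation sending the line at infinity to the line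
`tilt ε φ z = 0`. -/
noncomputable def tiltMatrix (ε φ : ℝ) : Matrix (Fin 3) (Fin 3) ℝ :=
  !![1, 0, 0; 0, 1, 0; ε * Real.cos φ, ε * Real.sin φ, 1]

/-- The inverse of the distortion is `z ↦ z / tilt ε φ z`. So this form vanishes on the horizon, and
it is positive on the side of the polygon. -/
noncomputable def tilt (ε φ : ℝ) (z : ℝ × ℝ) : ℝ :=
  1 - ε * (Real.cos φ * z.1 + Real.sin φ * z.2)

/-- The line `cos s * x + sin s * y = cos δ` passes through the points of the unit circle at angles
`s - δ` and `s + δ`. Substituting the inverse of the distortion and multiplying by `tilt` gives this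
form, which is affine and so makes sense beyond the horizon too. -/
noncomputable def lineForm (ε φ δ s : ℝ) (z : ℝ × ℝ) : ℝ :=
  Real.cos δ * tilt ε φ z - (Real.cos s * z.1 + Real.sin s * z.2)

/-- The last homogeneous coordinate of the image of the point of the unit circle at angle `θ`. -/
noncomputable def tiltWeight (ε φ θ : ℝ) : ℝ := 1 + ε * Real.cos (θ - φ)

noncomputable def tiltedPoint (ε φ θ : ℝ) : ℝ × ℝ :=
  (Real.cos θ / tiltWeight ε φ θ, Real.sin θ / tiltWeight ε φ θ)

/-- Both sides are affine in `z` and vanish on the same chord. For positive weights and `sin δ > 0`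
the factor is positive, so `lineForm` carries the sign of the orientation. -/
theorem orient_tiltedPoint {ε φ s δ : ℝ} (h1 : tiltWeight ε φ (s - δ) ≠ 0)
    (h2 : tiltWeight ε φ (s + δ) ≠ 0) (z : ℝ × ℝ) :
    orient (tiltedPoint ε φ (s - δ)) (tiltedPoint ε φ (s + δ)) z =
      2 * Real.sin δ / (tiltWeight ε φ (s - δ) * tiltWeight ε φ (s + δ)) *
        lineForm ε φ δ s z := by
  have e1 : tiltWeight ε φ (s - δ) = 1 + ε * (Real.cos (s - δ) * Real.cos φ +
    Real.sin (s - δ) * Real.sin φ) := by rw [tiltWeight, Real.cos_sub]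
  have e2 : tiltWeight ε φ (s + δ) = 1 + ε * (Real.cos (s + δ) * Real.cos φ +
    Real.sin (s + δ) * Real.sin φ) := by rw [tiltWeight, Real.cos_sub]
  have h0 : orient (tiltedPoint ε φ (s - δ)) (tiltedPoint ε φ (s + δ)) z =
      (Real.cos (s - δ) * Real.sin (s + δ) - Real.sin (s - δ) * Real.cos (s + δ) -
        z.2 * (Real.cos (s - δ) * tiltWeight ε φ (s + δ) -
          Real.cos (s + δ) * tiltWeight ε φ (s - δ)) +
        z.1 * (Real.sin (s - δ) * tiltWeight ε φ (s + δ) -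
          Real.sin (s + δ) * tiltWeight ε φ (s - δ))) /
      (tiltWeight ε φ (s - δ) * tiltWeight ε φ (s + δ)) := by
    simp only [orient, tiltedPoint]
    field_simp
    ring
  rw [h0, div_mul_eq_mul_div]
  congr 1
  rw [e1, e2, lineForm, tilt, Real.cos_sub, Real.cos_add, Real.sin_sub, Real.sin_add]
  linear_combination 2 * Real.sin δ * Real.cos δ *
    (1 - ε * (Real.cos φ * z.1 + Real.sin φ * z.2)) * Real.sin_sq_add_cos_sq s

theorem lineForm_tiltedPoint {ε φ s δ θ : ℝ} (h : tiltWeight ε φ θ ≠ 0) :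
    lineForm ε φ δ s (tiltedPoint ε φ θ) =
      2 * Real.sin ((θ - s + δ) / 2) * Real.sin ((θ - s - δ) / 2) / tiltWeight ε φ θ := by
  have e1 : tiltWeight ε φ θ = 1 + ε * (Real.cos θ * Real.cos φ +
    Real.sin θ * Real.sin φ) := by rw [tiltWeight, Real.cos_sub]
  have e2 : 2 * Real.sin ((θ - s + δ) / 2) * Real.sin ((θ - s - δ) / 2) =
      Real.cos δ - Real.cos (θ - s) := by
    rw [Real.cos_sub_cos, ← neg_sub (θ - s) δ, neg_div, Real.sin_neg, add_comm δ]
    ring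
  rw [e2, Real.cos_sub]
  simp only [lineForm, tilt, tiltedPoint]
  generalize tiltWeight ε φ θ = w at *
  field_simp
  rw [e1]
  ring

/-- The point with coordinates `X`, `Y` in the frame rotated by `α`. -/
noncomputable def framePoint (α X Y : ℝ) : ℝ × ℝ :=
  (X * Real.cos α - Y * Real.sin α, X * Real.sin α + Y * Real.cos α)

theorem lineForm_framePoint (ε φ δ s α X Y : ℝ) :
    lineForm ε φ δ s (framePoint α X Y) =
      Real.cos δ * (1 - ε * (Y * Real.sin (φ - α) + X * Real.cos (φ - α))) -
        (Y * Real.sin (s - α) + X * Real.cos (s - α)) := by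
  simp only [lineForm, tilt, framePoint, Real.sin_sub, Real.cos_sub]
  ring

/-- The sign of `lineForm` on the line through the vertices `i < j`. -/
noncomputable def chordSign (k : ℕ) (ε : ℝ) (i j : ℕ) (z : ℝ × ℝ) : SignType :=
  SignType.sign (lineForm ε (Real.pi / (2 * k : ℕ)) (Real.pi * (j - i : ℤ) / k)
    (Real.pi * (i + j : ℤ) / k) z)

theorem sign_add_of_abs_lt {a b : ℝ} (h : |a| < |b|) :
    SignType.sign (a + b) = SignType.sign b := by
  rcases lt_trichotomy b 0 with hb | rfl | hb
  · rw [abs_of_neg hb] at h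
    rw [sign_neg hb, sign_neg (by linarith [le_abs_self a])]
  · simp at h
    exact absurd h (not_lt.2 (abs_nonneg a))
  · rw [abs_of_pos hb] at h
    rw [sign_pos hb, sign_pos (by linarith [neg_abs_le a])]

theorem sin_pi_div_pos {k : ℕ} (hk : 3 ≤ k) : 0 < Real.sin (Real.pi / (2 * k : ℕ)) := by
  apply Real.sin_pos_of_pos_of_lt_pi
  · push_cast; positivity
  · exact div_lt_self Real.pi_pos (by exact_mod_cast (by omega : 1 < 2 * k))

/-- The slope of the direction `c` relative to the horizon. -/
noncomputable def slope (k c : ℕ) : ℝ :=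
  Real.sin (Real.pi / (2 * k : ℕ) - Real.pi * c / k)

/-- The horizon is turned by half the angular step `π / k`, so its normal direction `π / (2k)` never
agrees modulo π with the normal of a class. Each pencil therefore has its centre at a finite point.
-/
theorem slope_ne_zero {k : ℕ} (hk : 3 ≤ k) (c : ℕ) : slope k c ≠ 0 := by
  have h0 : (0 : ℝ) < k := by positivity
  have h1 : slope k c = Real.sin (Real.pi * (1 - 2 * c : ℤ) / (2 * k : ℕ)) := by
    unfold slope
    congr 1
    push_cast
    field_simp
  have h2 := sin_pi_div_le_abs_sin (n := 2 * k) (by omega) (m := 1 - 2 * c) (by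
    rintro ⟨m, hm⟩
    push_cast at hm
    rw [mul_assoc] at hm
    omega)
  have h3 := sin_pi_div_pos hk
  rw [h1, ← abs_pos]
  linarith

theorem abs_slope_le (k c : ℕ) : |slope k c| ≤ 1 := Real.abs_sin_le_one _

/-- The side of the chord `i j` on which the far point in direction `c` lies. -/
noncomputable def farSign (k c i j : ℕ) : SignType :=
  SignType.sign (-Real.sin (Real.pi * (i + j - c : ℤ) / k) / slope k c)

theorem not_dvd_of_ne {k c i j : ℕ} (hc : c < k) (hi : i < k) (hj : j < k)
    (h1 : i + j ≠ c) (h2 : i + j ≠ c + k) : ¬ (k : ℤ) ∣ (i + j - c : ℤ) := by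
  rintro ⟨m, hm⟩
  have hlt : (i : ℤ) + j - c < k * 2 := by omega
  have hgt : (k : ℤ) * (-1) < i + j - c := by omega
  rw [hm] at hlt hgt
  have hk : (0 : ℤ) < k := by omega
  have a1 := lt_of_mul_lt_mul_left hlt hk.le
  have a2 := lt_of_mul_lt_mul_left hgt hk.le
  have : m = 0 ∨ m = 1 := by omega
  rcases this with rfl | rfl
  · exact h1 (by omega)
  · exact h2 (by omega)

theorem sin_le_abs_sin_chord {k c i j : ℕ} (hk : 3 ≤ k) (hc : c < k) (hi : i < k) (hj : j < k)
    (h1 : i + j ≠ c) (h2 : i + j ≠ c + k) :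
    Real.sin (Real.pi / (2 * k : ℕ)) ≤ |Real.sin (Real.pi * (i + j - c : ℤ) / k)| := by
  have h0 : (0 : ℝ) < k := by positivity
  have h := sin_pi_div_le_abs_sin (n := 2 * k) (by omega) (m := 2 * (i + j - c)) (by
    push_cast
    rw [Int.mul_dvd_mul_iff_left two_ne_zero]
    exact not_dvd_of_ne hc hi hj h1 h2)
  convert h using 3
  push_cast
  field_simp

theorem farSign_ne_zero {k c i j : ℕ} (hk : 3 ≤ k) (hc : c < k) (hi : i < k) (hj : j < k)
    (h1 : i + j ≠ c) (h2 : i + j ≠ c + k) : farSign k c i j ≠ 0 := by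
  have h := sin_le_abs_sin_chord hk hc hi hj h1 h2
  have h3 := sin_pi_div_pos hk
  refine sign_ne_zero.2 (div_ne_zero (neg_ne_zero.2 ?_) (slope_ne_zero hk c))
  rw [← abs_pos]
  linarith

theorem chordSign_framePoint (k : ℕ) (ε : ℝ) (i j : ℕ) (α X Y : ℝ) :
    chordSign k ε i j (framePoint α X Y) =
      SignType.sign (Real.cos (Real.pi * (j - i : ℤ) / k) *
        (1 - ε * (Y * Real.sin (Real.pi / (2 * k : ℕ) - α) +
          X * Real.cos (Real.pi / (2 * k : ℕ) - α))) -
        (Y * Real.sin (Real.pi * (i + j : ℤ) / k - α) +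
          X * Real.cos (Real.pi * (i + j : ℤ) / k - α))) := by
  rw [chordSign, lineForm_framePoint]

theorem chord_angle_sub {k c i j : ℕ} :
    Real.pi * (i + j : ℤ) / k - Real.pi * c / k = Real.pi * (i + j - c : ℤ) / k := by
  push_cast; ring

theorem eventually_sign_add_smul {a : ℝ} (ha : a ≠ 0) (b : ℝ) :
    ∀ᶠ η in nhdsWithin (0 : ℝ) (Set.Ioi 0), SignType.sign (a + η * b) = SignType.sign a := by
  have hlim : Filter.Tendsto (fun η : ℝ => a + η * b) (nhdsWithin 0 (Set.Ioi 0)) (nhds a) := by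
    have h : Continuous fun η : ℝ => a + η * b := by fun_prop
    simpa using (h.tendsto 0).mono_left nhdsWithin_le_nhds
  rcases lt_or_gt_of_ne ha with h | h
  · filter_upwards [hlim.eventually (gt_mem_nhds h)] with η hη
    rw [sign_neg h, sign_neg hη]
  · filter_upwards [hlim.eventually (lt_mem_nhds h)] with η hη
    rw [sign_pos h, sign_pos hη]

/-- A point beyond the horizon, between two lines of class `c`. -/
theorem exists_point_beyond {k c e : ℕ} (hk : 3 ≤ k) (hc : c < k) (he : e ≤ k) {ε : ℝ}
    (hε : 0 < ε) : ∃ z, ∀ i j : ℕ, i < j → j < k →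
      (i + j = c → chordSign k ε i j z = SignType.sign (j - i - e : ℤ)) ∧
      (i + j = c + k → chordSign k ε i j z = SignType.sign (j - i - (k - e) : ℤ)) ∧
      (i + j ≠ c → i + j ≠ c + k → chordSign k ε i j z = farSign k c i j) := by
  have h0 : (0 : ℝ) < k := by positivity
  set ℓ := slope k c with hℓ
  have hℓ0 : ℓ ≠ 0 := slope_ne_zero hk c
  -- At height `1 / (ε * ℓ)` on the axis of the frame lies the centre of the pencil. The velocity
  -- `(x, y)` makes `tilt` equal to `-ε * η`, so the point passes beyond the horizon for `η > 0`; it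
  -- moves along the line of the pencil where a chord of length index `e` would lie.
  set x : ℝ := -ε * Real.cos (Real.pi * e / k) with hx
  set μ := Real.cos (Real.pi / (2 * k : ℕ) - Real.pi * c / k) with hμ
  set y : ℝ := (1 - x * μ) / ℓ with hy
  have key : ∀ η : ℝ, ∀ i j : ℕ,
      chordSign k ε i j (framePoint (Real.pi * c / k) (η * x) (1 / (ε * ℓ) + η * y)) =
      SignType.sign (-Real.sin (Real.pi * (i + j - c : ℤ) / k) / (ε * ℓ) +
        η * (-ε * Real.cos (Real.pi * (j - i : ℤ) / k) -
          y * Real.sin (Real.pi * (i + j - c : ℤ) / k) -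
          x * Real.cos (Real.pi * (i + j - c : ℤ) / k))) := by
    intro η i j
    rw [chordSign_framePoint, chord_angle_sub, ← hμ, ← slope, ← hℓ]
    have h1 : 1 - ε * ((1 / (ε * ℓ) + η * y) * ℓ + η * x * μ) = -ε * η := by
      rw [hy]; field_simp; ring
    rw [h1]
    congr 1
    field_simp
    ring
  have hev : ∀ᶠ η in nhdsWithin (0 : ℝ) (Set.Ioi 0), ∀ i j : Fin k, (i : ℕ) + j ≠ c →
      (i : ℕ) + j ≠ c + k →
      chordSign k ε i j (framePoint (Real.pi * c / k) (η * x) (1 / (ε * ℓ) + η * y)) =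
        farSign k c i j := by
    rw [Filter.eventually_all]
    intro i
    rw [Filter.eventually_all]
    intro j
    simp only [Filter.eventually_imp_distrib_left]
    intro h1 h2
    -- At `η = 0` the forms of the chords outside the class are nonzero, so their signs persist for
    -- small `η`.
    have hs : -Real.sin (Real.pi * (i + j - c : ℤ) / k) / (ε * ℓ) =
        ε⁻¹ * (-Real.sin (Real.pi * (i + j - c : ℤ) / k) / ℓ) := by field_simp
    have hsign : SignType.sign (-Real.sin (Real.pi * (i + j - c : ℤ) / k) / (ε * ℓ)) =
        farSign k c i j := by
      rw [hs, sign_mul, sign_pos (inv_pos.2 hε), one_mul, farSign]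
    have hne := farSign_ne_zero hk hc i.2 j.2 h1 h2
    filter_upwards [eventually_sign_add_smul (sign_ne_zero.1 (hsign ▸ hne)) _] with η hη
    rw [key, hη, hsign]
  obtain ⟨η, hη, hη0⟩ := (hev.and self_mem_nhdsWithin).exists
  have hηε : 0 < η * ε := mul_pos hη0 hε
  refine ⟨_, fun i j hij hj => ⟨fun h => ?_, fun h => ?_, fun h1 h2 =>
    hη ⟨i, hij.trans hj⟩ ⟨j, hj⟩ h1 h2⟩⟩
  · have h1 : (i + j - c : ℤ) = 0 := by omega
    rw [key, h1]
    have h2 : -Real.sin (Real.pi * (0 : ℤ) / k) / (ε * ℓ) +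
        η * (-ε * Real.cos (Real.pi * (j - i : ℤ) / k) -
          y * Real.sin (Real.pi * (0 : ℤ) / k) - x * Real.cos (Real.pi * (0 : ℤ) / k)) =
        η * ε * (Real.cos (Real.pi * (e : ℤ) / k) - Real.cos (Real.pi * (j - i : ℤ) / k)) := by
      simp only [hx, Int.cast_zero, mul_zero, zero_div, Real.sin_zero, Real.cos_zero,
        Int.cast_natCast]
      ring
    rw [h2, sign_mul, sign_pos hηε, one_mul]
    exact sign_cos_sub_cos (by omega) (by omega) (by omega) (by omega)
  · have h1 : (i + j - c : ℤ) = k := by omega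
    rw [key, h1]
    have h3 : Real.pi * ((k : ℤ) : ℝ) / k = Real.pi := by push_cast; field_simp
    have h4 : Real.cos (Real.pi * (k - e : ℤ) / k) = -Real.cos (Real.pi * e / k) := by
      rw [← Real.cos_pi_sub]
      congr 1
      push_cast
      field_simp
    rw [h3, Real.sin_pi, Real.cos_pi]
    have h2 : -0 / (ε * ℓ) + η * (-ε * Real.cos (Real.pi * (j - i : ℤ) / k) - y * 0 - x * -1) =
        η * ε * (Real.cos (Real.pi * (k - e : ℤ) / k) -
          Real.cos (Real.pi * (j - i : ℤ) / k)) := by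
      rw [h4, hx]
      ring
    rw [h2, sign_mul, sign_pos hηε, one_mul]
    exact sign_cos_sub_cos (by omega) (by omega) (by omega) (by omega)

/-- A point on the near side of the horizon, beside all lines of class `c`. -/
theorem exists_point_opposite {k c : ℕ} (hk : 3 ≤ k) (hc : c < k) {ε : ℝ} (hε : 0 < ε)
    (hεk : 12 * ε = Real.sin (Real.pi / (2 * k : ℕ))) (b : SignType) (hb : b ≠ 0) :
    ∃ z, ∀ i j : ℕ, i < j → j < k →
      (i + j = c → chordSign k ε i j z = -b) ∧
      (i + j = c + k → chordSign k ε i j z = b) ∧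
      (i + j ≠ c → i + j ≠ c + k → chordSign k ε i j z = -farSign k c i j) := by
  have h0 : (0 : ℝ) < k := by positivity
  set ℓ := slope k c with hℓ
  have hℓ0 : ℓ ≠ 0 := slope_ne_zero hk c
  have hℓ1 : |ℓ| ≤ 1 := abs_slope_le k c
  set μ := Real.cos (Real.pi / (2 * k : ℕ) - Real.pi * c / k) with hμ
  have hμ1 : |μ| ≤ 1 := Real.abs_cos_le_one _
  have hε1 : 12 * ε ≤ 1 := hεk ▸ Real.sin_le_one _
  have hb1 : |(b : ℝ)| = 1 := by revert hb; cases b <;> simp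
  have hbs : SignType.sign (b : ℝ) = b := by cases b <;> simp
  set t : ℝ := (b : ℝ) with ht
  -- The height is minus that of the centre of the pencil, which reverses the dominant term for the
  -- chords of other classes. It makes `tilt` about 2, so the offset `3 * t` outweighs the term `D *
  -- tilt` and clears the whole class on the side chosen by `b`.
  refine ⟨framePoint (Real.pi * c / k) (3 * t) (-(1 / (ε * ℓ))), fun i j hij hj => ?_⟩
  set D := Real.cos (Real.pi * (j - i : ℤ) / k) with hD
  have hD1 : |D| ≤ 1 := Real.abs_cos_le_one _
  have hA : |D * (2 - 3 * ε * (t * μ))| < 9 / 4 + 1 / 8 := by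
    rw [abs_mul]
    have h1 : |t * μ| ≤ 1 := by rw [abs_mul, hb1, one_mul]; exact hμ1
    obtain ⟨h2, h3⟩ := abs_le.1 h1
    have h4 : |2 - 3 * ε * (t * μ)| ≤ 9 / 4 := by
      rw [abs_le]; constructor <;> nlinarith
    nlinarith [abs_nonneg D, abs_nonneg (2 - 3 * ε * (t * μ))]
  have key : chordSign k ε i j (framePoint (Real.pi * c / k) (3 * t) (-(1 / (ε * ℓ)))) =
      SignType.sign (D * (2 - 3 * ε * (t * μ)) +
        Real.sin (Real.pi * (i + j - c : ℤ) / k) / (ε * ℓ) -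
        3 * t * Real.cos (Real.pi * (i + j - c : ℤ) / k)) := by
    rw [chordSign_framePoint, chord_angle_sub, ← hμ, ← slope, ← hℓ]
    congr 1
    field_simp
    ring
  rw [key]
  refine ⟨fun h => ?_, fun h => ?_, fun h1 h2 => ?_⟩
  · have h1 : (i + j - c : ℤ) = 0 := by omega
    rw [h1]
    have h2 : D * (2 - 3 * ε * (t * μ)) + Real.sin (Real.pi * (0 : ℤ) / k) / (ε * ℓ) -
        3 * t * Real.cos (Real.pi * (0 : ℤ) / k) =
        D * (2 - 3 * ε * (t * μ)) + -(3 * t) := by simp; ring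
    rw [h2, sign_add_of_abs_lt, Left.sign_neg, sign_mul, hbs, sign_pos three_pos, one_mul]
    rw [abs_neg, abs_mul 3 t, hb1, abs_of_pos (three_pos : (0 : ℝ) < 3)]
    linarith
  · have h1 : (i + j - c : ℤ) = k := by omega
    have h3 : Real.pi * ((k : ℤ) : ℝ) / k = Real.pi := by push_cast; field_simp
    rw [h1, h3, Real.sin_pi, Real.cos_pi]
    have h2 : D * (2 - 3 * ε * (t * μ)) + 0 / (ε * ℓ) - 3 * t * -1 =
        D * (2 - 3 * ε * (t * μ)) + 3 * t := by ring
    rw [h2, sign_add_of_abs_lt, sign_mul, hbs, sign_pos three_pos, one_mul]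
    rw [abs_mul 3 t, hb1, abs_of_pos (three_pos : (0 : ℝ) < 3)]
    linarith
  · have hsin := sin_le_abs_sin_chord hk hc (hij.trans hj) hj h1 h2
    set σ := Real.sin (Real.pi * (i + j - c : ℤ) / k) with hσ
    have hC := Real.abs_cos_le_one (Real.pi * (i + j - c : ℤ) / k)
    set C := Real.cos (Real.pi * (i + j - c : ℤ) / k)
    have hf : farSign k c i j = -SignType.sign (σ / (ε * ℓ)) := by
      have h3 : -σ / ℓ = ε * -(σ / (ε * ℓ)) := by field_simp
      rw [farSign, ← hσ, ← hℓ, h3, sign_mul, sign_pos hε, one_mul, Left.sign_neg]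
    rw [hf, neg_neg]
    have h3 : D * (2 - 3 * ε * (t * μ)) + σ / (ε * ℓ) - 3 * t * C =
        (D * (2 - 3 * ε * (t * μ)) - 3 * t * C) + σ / (ε * ℓ) := by ring
    rw [h3]
    apply sign_add_of_abs_lt
    have h4 : |3 * t * C| ≤ 3 := by
      rw [abs_mul, abs_mul, hb1, abs_of_pos three_pos]; linarith
    -- This is where the choice of `ε` enters: 12 exceeds the sum of the other terms, at most `9 / 4
    -- + 1 / 8 + 3`.
    have h5 : 12 ≤ |σ / (ε * ℓ)| := by
      rw [abs_div, le_div_iff₀ (abs_pos.2 (mul_ne_zero hε.ne' hℓ0)), abs_mul, abs_of_pos hε]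
      nlinarith [abs_nonneg ℓ]
    have h6 := abs_sub (D * (2 - 3 * ε * (t * μ))) (3 * t * C)
    linarith

/-- A far point whose direction is perpendicular to none of the classes of lines. -/
theorem exists_point_far {k l : ℕ} (hk : 3 ≤ k) (hl : l < k) {ε : ℝ} (hε : 0 < ε)
    (hεk : 12 * ε = Real.sin (Real.pi / (2 * k : ℕ))) :
    ∃ z, ∀ c i j : ℕ, c < k → i < j → j < k →
      (i + j = c → chordSign k ε i j z = (-1) ^ l * (if l ≤ c then 1 else -1)) ∧
      (i + j = c + k → chordSign k ε i j z = -((-1) ^ l * (if l ≤ c then 1 else -1))) := by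
  have h0 : (0 : ℝ) < k := by positivity
  have hε1 : 12 * ε ≤ 1 := hεk ▸ Real.sin_le_one _
  set t : ℝ := (-1) ^ l with ht
  have ht1 : |t| = 1 := by rw [ht, abs_pow, abs_neg, abs_one, one_pow]
  have hts : SignType.sign t = (-1) ^ l := by rw [ht, sign_pow]; simp
  -- With this angle the normal of class `c` has component `-sin (π (2 (c - l) + 1) / (2k))` along
  -- the direction `β`: its sign switches between `c = l - 1` and `c = l`, and it is never zero. At
  -- distance `1 / (3 * ε)` the `tilt` stays within `[2/3, 4/3]`, while the offset from the class is
  -- at least 4.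
  set β : ℝ := Real.pi * l / k - Real.pi / 2 - Real.pi / (2 * k : ℕ) with hβ
  refine ⟨framePoint β (t / (3 * ε)) 0, fun c i j hc hij hj => ?_⟩
  set D := Real.cos (Real.pi * (j - i : ℤ) / k) with hD
  have hD1 : |D| ≤ 1 := Real.abs_cos_le_one _
  set μ := Real.cos (Real.pi / (2 * k : ℕ) - β) with hμ
  have hμ1 : |μ| ≤ 1 := Real.abs_cos_le_one _
  set σ := Real.sin (Real.pi * (2 * (c - l) + 1 : ℤ) / (2 * k : ℕ)) with hσ
  have hσs : SignType.sign σ = if l ≤ c then 1 else -1 := by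
    rw [hσ, sign_sin_pi_mul_div (by rw [abs_lt]; push_cast; constructor <;> omega)]
    split_ifs with h
    · exact sign_pos (by omega)
    · exact sign_neg (by omega)
  have hσ1 : 12 * ε ≤ |σ| := by
    rw [hεk]
    refine sin_pi_div_le_abs_sin (by omega) ?_
    rintro ⟨m, hm⟩
    push_cast at hm
    rw [mul_assoc] at hm
    omega
  have hA : |D * (1 - t * μ / 3)| < 2 := by
    rw [abs_mul]
    have h1 : |t * μ| ≤ 1 := by rw [abs_mul, ht1, one_mul]; exact hμ1
    obtain ⟨h2, h3⟩ := abs_le.1 h1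
    have h4 : |1 - t * μ / 3| ≤ 4 / 3 := by
      rw [abs_le]; constructor <;> linarith
    nlinarith [abs_nonneg D, abs_nonneg (1 - t * μ / 3)]
  have hB : 4 ≤ |t * σ / (3 * ε)| := by
    rw [abs_div, le_div_iff₀ (abs_pos.2 (by positivity)), abs_mul t σ, ht1,
      abs_of_pos (by positivity : 0 < 3 * ε)]
    linarith
  have hBs : SignType.sign (t * σ / (3 * ε)) = (-1) ^ l * (if l ≤ c then 1 else -1) := by
    have h1 : t * σ / (3 * ε) = (3 * ε)⁻¹ * (t * σ) := by field_simp
    rw [h1, sign_mul, sign_pos (by positivity), one_mul, sign_mul, hts, hσs]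
  have key : chordSign k ε i j (framePoint β (t / (3 * ε)) 0) =
      SignType.sign (D * (1 - t * μ / 3) +
        -(t / (3 * ε) * Real.cos (Real.pi * (i + j : ℤ) / k - β))) := by
    rw [chordSign_framePoint, ← hμ, ← hD]
    congr 1
    field_simp
    ring
  have hang : Real.cos (Real.pi * c / k - β) = -σ := by
    rw [hσ, ← Real.cos_add_pi_div_two]
    congr 1
    rw [hβ]
    push_cast
    field_simp
    ring
  rw [key]
  constructor
  · intro h
    have h1 : Real.pi * (i + j : ℤ) / k - β = Real.pi * c / k - β := by
      rw [← h]; push_cast; ring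
    have h2 : -(t / (3 * ε) * -σ) = t * σ / (3 * ε) := by ring
    rw [h1, hang, h2, sign_add_of_abs_lt (by linarith), hBs]
  · intro h
    have h1 : Real.pi * (i + j : ℤ) / k - β = Real.pi * c / k - β + Real.pi := by
      have : ((i + j : ℤ) : ℝ) = c + k := by exact_mod_cast h
      rw [this]; field_simp; ring
    have h2 : -(t / (3 * ε) * - -σ) = -(t * σ / (3 * ε)) := by ring
    rw [h1, Real.cos_add_pi, hang, h2, sign_add_of_abs_lt (by rw [abs_neg]; linarith),
      Left.sign_neg, hBs]

/-! ### The distorted polygon -/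

/-- The perturbed regular `k`-gon used in the construction. -/
noncomputable def tiltedPolygon (k : ℕ) (ε : ℝ) (i : Fin k) : ℝ × ℝ :=
  tiltedPoint ε (Real.pi / (2 * k : ℕ)) (2 * Real.pi * (i : ℕ) / k)

theorem tiltWeight_pos {ε φ θ : ℝ} (hε : 0 < ε) (hε1 : 12 * ε ≤ 1) : 0 < tiltWeight ε φ θ := by
  unfold tiltWeight
  nlinarith [Real.neg_one_le_cos (θ - φ)]

theorem homImage_tiltMatrix (k : ℕ) (ε φ : ℝ) (i : Fin k) :
    homImage (tiltMatrix ε φ) (polygonVertex k i) =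
      ![Real.cos (2 * Real.pi * (i : ℕ) / k), Real.sin (2 * Real.pi * (i : ℕ) / k),
        tiltWeight ε φ (2 * Real.pi * (i : ℕ) / k)] := by
  unfold homImage tiltMatrix polygonVertex tiltWeight
  rw [Real.cos_sub]
  ext a
  fin_cases a <;> simp [Matrix.mulVec, dotProduct, Fin.sum_univ_three]
  ring

theorem sin_pi_mul_ne_zero {k : ℕ} {i j : Fin k} (h : i ≠ j) :
    Real.sin (Real.pi * ((i : ℕ) - (j : ℕ) : ℤ) / k) ≠ 0 := by
  have hi := i.2
  have hj := j.2
  rw [Ne, Fin.ext_iff] at h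
  rw [← sign_ne_zero, sign_sin_pi_mul_div (by rw [abs_lt]; constructor <;> omega), sign_ne_zero]
  omega

/-- By the sum-to-product formula the difference of the weights is a multiple of `slope k (i + j)`
and of the sine of half the angle between the vertices, neither of which vanishes. -/
theorem tiltWeight_ne {k : ℕ} (hk : 3 ≤ k) {ε : ℝ} (hε : 0 < ε) {i j : Fin k} (h : i ≠ j) :
    tiltWeight ε (Real.pi / (2 * k : ℕ)) (2 * Real.pi * (i : ℕ) / k) ≠
      tiltWeight ε (Real.pi / (2 * k : ℕ)) (2 * Real.pi * (j : ℕ) / k) := by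
  intro heq
  have h0 : (0 : ℝ) < k := by positivity
  unfold tiltWeight at heq
  have h1 := sub_eq_zero.2 (mul_left_cancel₀ hε.ne' (add_left_cancel heq))
  rw [Real.cos_sub_cos] at h1
  have h2 : Real.sin ((2 * Real.pi * (i : ℕ) / k - Real.pi / (2 * k : ℕ) +
      (2 * Real.pi * (j : ℕ) / k - Real.pi / (2 * k : ℕ))) / 2) = -slope k (i + j) := by
    rw [slope, ← Real.sin_neg]
    congr 1
    push_cast
    ring
  have h3 : (2 * Real.pi * (i : ℕ) / k - Real.pi / (2 * k : ℕ) -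
      (2 * Real.pi * (j : ℕ) / k - Real.pi / (2 * k : ℕ))) / 2 =
      Real.pi * ((i : ℕ) - (j : ℕ) : ℤ) / k := by
    push_cast
    ring
  rw [h2, h3] at h1
  have := slope_ne_zero hk (i + j)
  have := sin_pi_mul_ne_zero h
  simp_all

theorem isDistortedRegularPolygon_tiltedPolygon {k : ℕ} (hk : 3 ≤ k) {ε : ℝ} (hε : 0 < ε)
    (hε1 : 12 * ε ≤ 1) : IsDistortedRegularPolygon k (tiltedPolygon k ε) := by
  refine ⟨tiltMatrix ε (Real.pi / (2 * k : ℕ)), ?_, fun i => ?_, fun i j hij => ?_, fun i => ?_⟩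
  · simp [tiltMatrix, Matrix.det_fin_three]
  · rw [homImage_tiltMatrix]
    exact tiltWeight_pos hε hε1
  · rw [homImage_tiltMatrix, homImage_tiltMatrix]
    exact tiltWeight_ne hk hε hij
  · rw [projImage, homImage_tiltMatrix]
    rfl

theorem orient_tiltedPolygon {k : ℕ} {ε : ℝ} (hε : 0 < ε) (hε1 : 12 * ε ≤ 1) (i j : Fin k)
    (z : ℝ × ℝ) : SignType.sign (orient (tiltedPolygon k ε i) (tiltedPolygon k ε j) z) =
      SignType.sign ((j : ℤ) - i) * chordSign k ε i j z := by
  have hi := i.2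
  have hj := j.2
  have h1 : 2 * Real.pi * (i : ℕ) / k =
      Real.pi * ((i : ℕ) + (j : ℕ) : ℤ) / k - Real.pi * ((j : ℕ) - (i : ℕ) : ℤ) / k := by
    push_cast; ring
  have h2 : 2 * Real.pi * (j : ℕ) / k =
      Real.pi * ((i : ℕ) + (j : ℕ) : ℤ) / k + Real.pi * ((j : ℕ) - (i : ℕ) : ℤ) / k := by
    push_cast; ring
  rw [tiltedPolygon, tiltedPolygon, h1, h2,
    orient_tiltedPoint (tiltWeight_pos hε hε1).ne' (tiltWeight_pos hε hε1).ne', sign_mul,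
    div_eq_mul_inv, sign_mul, sign_mul, sign_pos two_pos, one_mul,
    sign_pos (inv_pos.2 (mul_pos (tiltWeight_pos hε hε1) (tiltWeight_pos hε hε1))), mul_one,
    sign_sin_pi_mul_div (by rw [abs_lt]; constructor <;> omega)]
  rfl

theorem orient_tiltedPolygon_vertex {k : ℕ} {ε : ℝ} (hε : 0 < ε) (hε1 : 12 * ε ≤ 1)
    (i j l : Fin k) :
    SignType.sign (orient (tiltedPolygon k ε i) (tiltedPolygon k ε j) (tiltedPolygon k ε l)) =
      SignType.sign ((j : ℤ) - i) * (SignType.sign ((l : ℤ) - i) * SignType.sign ((l : ℤ) - j)) := by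
  have hi := i.2
  have hj := j.2
  have hl := l.2
  rw [orient_tiltedPolygon hε hε1, chordSign, tiltedPolygon,
    lineForm_tiltedPoint (tiltWeight_pos hε hε1).ne', div_eq_mul_inv, sign_mul, sign_mul, sign_mul,
    sign_pos two_pos, one_mul, sign_pos (inv_pos.2 (tiltWeight_pos hε hε1)), mul_one]
  have h1 : (2 * Real.pi * (l : ℕ) / k - Real.pi * ((i : ℕ) + (j : ℕ) : ℤ) / k +
      Real.pi * ((j : ℕ) - (i : ℕ) : ℤ) / k) / 2 = Real.pi * ((l : ℕ) - (i : ℕ) : ℤ) / k := by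
    push_cast; ring
  have h2 : (2 * Real.pi * (l : ℕ) / k - Real.pi * ((i : ℕ) + (j : ℕ) : ℤ) / k -
      Real.pi * ((j : ℕ) - (i : ℕ) : ℤ) / k) / 2 = Real.pi * ((l : ℕ) - (j : ℕ) : ℤ) / k := by
    push_cast; ring
  rw [h1, h2, sign_sin_pi_mul_div (by rw [abs_lt]; constructor <;> omega),
    sign_sin_pi_mul_div (by rw [abs_lt]; constructor <;> omega)]

theorem tiltedPolygon_injective {k : ℕ} (hk : 3 ≤ k) {ε : ℝ} (hε : 0 < ε) (hε1 : 12 * ε ≤ 1) :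
    Function.Injective (tiltedPolygon k ε) := by
  intro i j hij
  by_contra hne
  have hi := i.2
  have hj := j.2
  rw [Fin.ext_iff] at hne
  -- If two vertices coincided, their orientation with any third vertex would be zero, against the
  -- sign formula.
  obtain ⟨l, hl, hli, hlj⟩ : ∃ l < k, l ≠ i ∧ l ≠ j := by
    by_contra! h
    have h0 := h 0 (by omega)
    have h1 := h 1 (by omega)
    have h2 := h 2 (by omega)
    omega
  have h := orient_tiltedPolygon_vertex hε hε1 i j ⟨l, hl⟩
  have h0 : orient (tiltedPolygon k ε i) (tiltedPolygon k ε j) (tiltedPolygon k ε ⟨l, hl⟩) = 0 := by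
    rw [hij]; simp [orient]
  rw [h0, sign_zero, eq_comm] at h
  simp only [mul_eq_zero, sign_eq_zero_iff] at h
  omega

theorem generalPosition_tiltedPolygon {k : ℕ} {ε : ℝ} (hε : 0 < ε) (hε1 : 12 * ε ≤ 1) :
    GeneralPosition (vertexSet (tiltedPolygon k ε)) := by
  rw [generalPosition_iff]
  simp only [vertexSet, Finset.mem_image, Finset.mem_univ, true_and]
  rintro _ ⟨i, rfl⟩ _ ⟨j, rfl⟩ _ ⟨l, rfl⟩ hij hil hjl
  have h1 : i ≠ j := fun h => hij (h ▸ rfl)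
  have h2 : i ≠ l := fun h => hil (h ▸ rfl)
  have h3 : j ≠ l := fun h => hjl (h ▸ rfl)
  rw [Ne, Fin.ext_iff] at h1 h2 h3
  rw [← sign_ne_zero, orient_tiltedPolygon_vertex hε hε1]
  simp only [ne_eq, mul_eq_zero, sign_eq_zero_iff]
  omega

/-! ### Prescribed sides and their realization -/

/-- The index of the chord length lying between the `u`-th and the next line of class `c`. -/
def gap (c u : ℕ) : ℕ := if Odd c then 2 * u + 2 else 2 * u + 3

/-- The side of the chord `i j` on which an added point is to lie. The points with index `inl`
form the clusters; the first boolean tells the points beyond the horizon from the compensating ones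
before it. The points with index `inr` are far away from the polygon. -/
noncomputable def targetSign {k : ℕ} {N : Fin k → ℕ} (i j : ℕ) :
    (Σ c : Fin k, Fin (N c) × Bool × Bool) ⊕ Fin k → SignType
  | .inl ⟨c, u, true, _⟩ =>
      if i + j = c then SignType.sign (j - i - gap c u : ℤ)
      else if i + j = c + k then SignType.sign (j - i - (k - gap c u) : ℤ)
      else farSign k c i j
  | .inl ⟨c, _, false, b⟩ =>
      if i + j = c then -(if b then 1 else -1)
      else if i + j = c + k then (if b then 1 else -1)
      else -farSign k c i j
  | .inr l =>
      if i + j < k then (-1) ^ (l : ℕ) * (if (l : ℕ) ≤ i + j then 1 else -1)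
      else -((-1) ^ (l : ℕ) * (if (l : ℕ) ≤ i + j - k then 1 else -1))

theorem targetSign_ne_zero {k : ℕ} (hk : 3 ≤ k) {N : Fin k → ℕ} {i j : ℕ} (hij : i < j)
    (hj : j < k) (x : (Σ c : Fin k, Fin (N c) × Bool × Bool) ⊕ Fin k) :
    targetSign i j x ≠ 0 := by
  rcases x with ⟨c, u, b₁, b₂⟩ | l
  · have hf := farSign_ne_zero (i := i) (j := j) hk c.2 (hij.trans hj) hj
    cases b₁
    · simp only [targetSign]
      split_ifs <;> simp_all
    · simp only [targetSign, gap]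
      split_ifs with h1 h2 h3
      · rw [Nat.odd_iff] at h2
        exact sign_ne_zero.2 (by push_cast; omega)
      · rw [Nat.odd_iff] at h2
        exact sign_ne_zero.2 (by push_cast; omega)
      · rw [Nat.odd_iff] at *
        exact sign_ne_zero.2 (by push_cast; omega)
      · rw [Nat.odd_iff] at *
        exact sign_ne_zero.2 (by push_cast; omega)
      · exact hf h1 h3
  · have : ((-1 : SignType) ^ (l : ℕ)) ≠ 0 := pow_ne_zero _ (by decide)
    simp only [targetSign]
    split_ifs <;> simp_all

theorem exists_target_point {k : ℕ} (hk : 3 ≤ k) {N : Fin k → ℕ}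
    (hN : ∀ c : Fin k, ∀ u < N c, gap c u ≤ k) {ε : ℝ} (hε : 0 < ε)
    (hεk : 12 * ε = Real.sin (Real.pi / (2 * k : ℕ)))
    (x : (Σ c : Fin k, Fin (N c) × Bool × Bool) ⊕ Fin k) :
    ∃ z, ∀ i j : ℕ, i < j → j < k → chordSign k ε i j z = targetSign i j x := by
  rcases x with ⟨c, u, b₁, b₂⟩ | l
  · cases b₁
    · obtain ⟨z, hz⟩ := exists_point_opposite hk c.2 hε hεk (if b₂ then 1 else -1) (by
        cases b₂ <;> decide)
      refine ⟨z, fun i j hij hj => ?_⟩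
      obtain ⟨h1, h2, h3⟩ := hz i j hij hj
      simp only [targetSign]
      split_ifs <;> simp_all
    · obtain ⟨z, hz⟩ := exists_point_beyond hk c.2 (hN c u u.2) hε
      refine ⟨z, fun i j hij hj => ?_⟩
      obtain ⟨h1, h2, h3⟩ := hz i j hij hj
      simp only [targetSign]
      split_ifs <;> simp_all
  · obtain ⟨z, hz⟩ := exists_point_far hk l.2 hε hεk
    refine ⟨z, fun i j hij hj => ?_⟩
    simp only [targetSign]
    by_cases h : i + j < k
    · rw [if_pos h]
      exact (hz (i + j) i j h hij hj).1 rfl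
    · rw [if_neg h]
      exact (hz (i + j - k) i j (by omega) hij hj).2 (by omega)

open Classical in
theorem exists_configuration {k : ℕ} (hk : 3 ≤ k) {N : Fin k → ℕ}
    (hN : ∀ c : Fin k, ∀ u < N c, gap c u ≤ k) :
    ∃ P : Fin k → ℝ × ℝ, IsDistortedRegularPolygon k P ∧ Function.Injective P ∧
      (∀ i j l : Fin k, i < j → SignType.sign (orient (P i) (P j) (P l)) =
        SignType.sign ((l : ℤ) - i) * SignType.sign ((l : ℤ) - j)) ∧
      ∃ z : (Σ c : Fin k, Fin (N c) × Bool × Bool) ⊕ Fin k → ℝ × ℝ,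
        Function.Injective z ∧ (∀ x, z x ∉ vertexSet P) ∧
        GeneralPosition (vertexSet P ∪ Finset.univ.image z) ∧
        ∀ x, ∀ i j : Fin k, i < j →
          SignType.sign (orient (P i) (P j) (z x)) = targetSign (i : ℕ) (j : ℕ) x := by
  -- This `ε` lets the least nonzero `|sin|` among the angles involved dominate the bounded terms in
  -- the placement of the added points.
  obtain ⟨ε, hεk⟩ : ∃ ε : ℝ, 12 * ε = Real.sin (Real.pi / (2 * k : ℕ)) :=
    ⟨Real.sin (Real.pi / (2 * k : ℕ)) / 12, by ring⟩
  have hε : 0 < ε := by linarith [sin_pi_div_pos hk]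
  have hε1 : 12 * ε ≤ 1 := hεk ▸ Real.sin_le_one _
  have hsub : ∀ i j : Fin k, i < j → SignType.sign ((j : ℤ) - i) = 1 := fun i j h =>
    sign_pos (by have := Fin.lt_def.1 h; omega)
  have hor : ∀ i j : Fin k, i < j → ∀ z,
      SignType.sign (orient (tiltedPolygon k ε i) (tiltedPolygon k ε j) z) =
        chordSign k ε i j z := fun i j h z => by
    rw [orient_tiltedPolygon hε hε1, hsub i j h, one_mul]
  choose z₀ hz₀ using exists_target_point hk hN hε hεk
  obtain ⟨z, h1, h2, h3, h4⟩ := exists_generic_perturbation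
    (generalPosition_tiltedPolygon (k := k) hε hε1)
    (((Finset.univ : Finset (Fin k × Fin k)).filter fun x => x.1 < x.2).image
      fun x => (tiltedPolygon k ε x.1, tiltedPolygon k ε x.2)) z₀ (by
      intro x y hy
      obtain ⟨⟨i, j⟩, hij, rfl⟩ := Finset.mem_image.1 hy
      have hij' : i < j := (Finset.mem_filter.1 hij).2
      rw [← sign_ne_zero, hor i j hij', hz₀ x i j hij' j.2]
      exact targetSign_ne_zero hk hij' j.2 x)
  refine ⟨tiltedPolygon k ε, isDistortedRegularPolygon_tiltedPolygon hk hε hε1,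
    tiltedPolygon_injective hk hε hε1, fun i j l hij => ?_, z, h1, h2, h3, fun x i j hij => ?_⟩
  · rw [orient_tiltedPolygon_vertex hε hε1, hsub i j hij, one_mul]
  · rw [h4 x (tiltedPolygon k ε i, tiltedPolygon k ε j) (Finset.mem_image.2 ⟨(i, j),
      Finset.mem_filter.2 ⟨Finset.mem_univ _, hij⟩, rfl⟩), hor i j hij, hz₀ x i j hij j.2]

/-! ### Summing the signs -/

theorem sum_range_le_indicator (a k : ℕ) (h : a ≤ k) :
    ∑ l ∈ Finset.range k, (if a ≤ l then (1 : ℤ) else 0) = k - a := by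
  induction k, h using Nat.le_induction with
  | base =>
    rw [sub_self]
    exact Finset.sum_eq_zero fun l hl => if_neg (by have := Finset.mem_range.1 hl; omega)
  | succ k hk ih =>
    rw [Finset.sum_range_succ, ih, if_pos hk]
    push_cast
    ring

/-- The `j - i - 1` vertices strictly between `i` and `j` count -1, the endpoints 0, and the
remaining ones +1. -/
theorem sum_vertex_sign {k : ℕ} {i j : ℕ} (hij : i < j) (hj : j < k) :
    ∑ l : Fin k, ((SignType.sign ((l : ℤ) - i) * SignType.sign ((l : ℤ) - j) : SignType) : ℤ) =
      k - 2 * (j - i) := by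
  rw [Fin.sum_univ_eq_sum_range (fun l =>
    ((SignType.sign ((l : ℤ) - i) * SignType.sign ((l : ℤ) - j) : SignType) : ℤ))]
  have h : ∀ l ∈ Finset.range k,
      ((SignType.sign ((l : ℤ) - i) * SignType.sign ((l : ℤ) - j) : SignType) : ℤ) =
      1 - (if i ≤ l then 1 else 0) - (if i + 1 ≤ l then 1 else 0) + (if j ≤ l then 1 else 0) +
        (if j + 1 ≤ l then 1 else 0) := by
    intro l _
    have hs : ∀ a : ℕ, (SignType.sign ((l : ℤ) - a) : ℤ) =
        -1 + (if a ≤ l then 1 else 0) + (if a + 1 ≤ l then 1 else 0) := by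
      intro a
      rcases lt_trichotomy l a with h | rfl | h
      · rw [sign_neg (by omega), if_neg (by omega), if_neg (by omega)]; rfl
      · simp
      · rw [sign_pos (by omega), if_pos (by omega), if_pos (by omega)]; rfl
    rw [SignType.coe_mul, hs, hs]
    split_ifs <;> omega
  rw [Finset.sum_congr rfl h]
  simp only [Finset.sum_add_distrib, Finset.sum_sub_distrib]
  rw [sum_range_le_indicator i k (by omega), sum_range_le_indicator (i + 1) k (by omega),
    sum_range_le_indicator j k (by omega), sum_range_le_indicator (j + 1) k (by omega)]
  simp
  ring

/-- The first `t` gaps precede the chord and count +1, the remaining `N - t` count -1. -/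
theorem sum_sign_gap {t N : ℕ} (h : t ≤ N) :
    ∑ u : Fin N, (SignType.sign (2 * t - 2 * (u : ℕ) - 1 : ℤ) : ℤ) = 2 * t - N := by
  rw [Fin.sum_univ_eq_sum_range (fun u => (SignType.sign (2 * t - 2 * u - 1 : ℤ) : ℤ))]
  induction N, h using Nat.le_induction with
  | base =>
    rw [Finset.sum_congr rfl (g := fun _ => (1 : ℤ)) fun l hl => ?_]
    · simp; ring
    · rw [sign_pos (by have := Finset.mem_range.1 hl; omega)]; rfl
  | succ N hN ih =>
    rw [Finset.sum_range_succ, ih, sign_neg (by omega), SignType.coe_neg, SignType.coe_one]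
    push_cast
    ring

/-- Each `u` has two points beyond the horizon and two compensating ones. The latter have opposite
signs on chords of class `c`, where they cancel each other; on other chords they cancel the former.
-/
theorem sum_cluster {k : ℕ} {N : Fin k → ℕ} (i j : ℕ) (c : Fin k) :
    ∑ y : Fin (N c) × Bool × Bool, (targetSign (N := N) i j (.inl ⟨c, y⟩) : ℤ) =
      if i + j = c then 2 * ∑ u : Fin (N c), (SignType.sign (j - i - gap c u : ℤ) : ℤ)
      else if i + j = c + k then
        2 * ∑ u : Fin (N c), (SignType.sign (j - i - (k - gap c u) : ℤ) : ℤ)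
      else 0 := by
  simp only [Fintype.sum_prod_type, Fintype.sum_bool, targetSign, if_true, Bool.false_eq_true,
    if_false]
  by_cases h1 : i + j = c
  · simp only [if_pos h1, Finset.mul_sum]
    refine Finset.sum_congr rfl fun u _ => ?_
    simp only [SignType.coe_neg, SignType.coe_one]
    ring
  by_cases h2 : i + j = c + k
  · simp only [if_neg h1, if_pos h2, Finset.mul_sum]
    refine Finset.sum_congr rfl fun u _ => ?_
    simp only [SignType.coe_neg, SignType.coe_one]
    ring
  · simp only [if_neg h1, if_neg h2]
    refine Finset.sum_eq_zero fun u _ => ?_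
    simp only [SignType.coe_neg]
    ring

/-- The class of the chord `i j`. -/
def chordClass {k : ℕ} (hk : 0 < k) (i j : ℕ) : Fin k := ⟨(i + j) % k, Nat.mod_lt _ hk⟩

theorem chordClass_eq_or {k : ℕ} (hk : 0 < k) {i j : ℕ} (hi : i < k) (hj : j < k) :
    i + j = chordClass hk i j ∨ i + j = chordClass hk i j + k := by
  unfold chordClass
  simp only
  by_cases h : i + j < k
  · left; rw [Nat.mod_eq_of_lt h]
  · right; rw [Nat.mod_eq_sub_mod (by omega), Nat.mod_eq_of_lt (by omega)]; omega

theorem sum_cluster_of_ne {k : ℕ} (hk : 0 < k) {N : Fin k → ℕ} {i j : ℕ} {c : Fin k}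
    (h : c ≠ chordClass hk i j) :
    ∑ y : Fin (N c) × Bool × Bool, (targetSign (N := N) i j (.inl ⟨c, y⟩) : ℤ) = 0 := by
  have hc := c.2
  rw [sum_cluster, if_neg, if_neg]
  · intro h1
    refine h (Fin.ext ?_)
    simp only [chordClass, h1, Nat.add_mod_right, Nat.mod_eq_of_lt hc]
  · intro h1
    refine h (Fin.ext ?_)
    simp only [chordClass, h1, Nat.mod_eq_of_lt hc]

/-- The balance of the cluster of the class of `i j`, where `o = 0` for odd and `o = 1` for even
classes. -/
theorem sum_cluster_self {k : ℕ} (hk : 0 < k) {N : Fin k → ℕ} {i j : ℕ} {c : Fin k} {o t : ℕ}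
    (ho : ∀ u, gap c u = 2 * u + 2 + o) (ht : t ≤ N c)
    (h : (i + j = c ∧ j = i + (2 * t + 1 + o)) ∨
      (i + j = c + k ∧ i + k = j + (2 * t + 1 + o))) :
    ∑ y : Fin (N c) × Bool × Bool, (targetSign (N := N) i j (.inl ⟨c, y⟩) : ℤ) =
      if i + j = c then 2 * (2 * t - N c : ℤ) else -(2 * (2 * t - N c : ℤ)) := by
  rw [sum_cluster]
  -- On the half `i + j = c + k` of the class the normal is reversed. There `k - (j - i)` plays the
  -- part of the length, with the same parity as `c`, and the sum changes sign.
  rcases h with ⟨h1, h2⟩ | ⟨h1, h2⟩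
  · rw [if_pos h1, if_pos h1, ← sum_sign_gap ht]
    congr 1
    refine Finset.sum_congr rfl fun u _ => ?_
    congr 2
    rw [ho]
    push_cast
    omega
  · have h3 : ¬ i + j = c := by omega
    rw [if_neg h3, if_neg h3, if_pos h1, ← sum_sign_gap ht, ← mul_neg, ← Finset.sum_neg_distrib]
    congr 1
    refine Finset.sum_congr rfl fun u _ => ?_
    rw [← SignType.coe_neg, ← Left.sign_neg]
    congr 2
    rw [ho]
    push_cast
    omega

/-- A class has `k / 2` chords if odd and `k / 2 - 1` if even, hence one gap fewer. In either case
doubling the gap count yields exactly the negative of the vertex imbalance. -/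
theorem sum_cluster_even {k : ℕ} (hk : 0 < k) (hke : Even k) {N : Fin k → ℕ}
    (hN : ∀ c : Fin k, N c = if Odd (c : ℕ) then k / 2 - 1 else k / 2 - 2) {i j : ℕ}
    (hij : i < j) (hj : j < k) :
    ∑ y : Fin (N (chordClass hk i j)) × Bool × Bool,
      (targetSign (N := N) i j (.inl ⟨chordClass hk i j, y⟩) : ℤ) = 2 * (j - i) - k := by
  have hc := chordClass_eq_or hk (hij.trans hj) hj
  generalize chordClass hk i j = c at *
  have hck := c.2
  have hNc := hN c
  obtain ⟨h, rfl⟩ := hke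
  by_cases ho : Odd (c : ℕ)
  · rw [if_pos ho] at hNc
    have ho' := Nat.odd_iff.1 ho
    have hg : ∀ u, gap c u = 2 * u + 2 + 0 := fun u => by simp [gap, ho]
    rcases hc with hc | hc
    · rw [sum_cluster_self hk (t := (j - i) / 2) hg (by omega) (Or.inl ⟨hc, by omega⟩), if_pos hc]
      omega
    · rw [sum_cluster_self hk (t := (i + (h + h) - j) / 2) hg (by omega)
        (Or.inr ⟨hc, by omega⟩), if_neg (by omega)]
      omega
  · rw [if_neg ho] at hNc
    have ho' := Nat.not_odd_iff.1 ho
    have hg : ∀ u, gap c u = 2 * u + 2 + 1 := fun u => by simp [gap, ho]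
    rcases hc with hc | hc
    · rw [sum_cluster_self hk (t := (j - i) / 2 - 1) hg (by omega) (Or.inl ⟨hc, by omega⟩),
        if_pos hc]
      omega
    · rw [sum_cluster_self hk (t := (i + (h + h) - j) / 2 - 1) hg (by omega)
        (Or.inr ⟨hc, by omega⟩), if_neg (by omega)]
      omega

/-- For odd `k` every class has `(k - 1) / 2` chords, but their lengths are not placed symmetrically
about `k / 2`; this shifts the balance by one. Passing to `i + j = c + k` flips both the sign and
the parity of `i + j`, so the error depends on that parity alone. -/
theorem sum_cluster_odd {k : ℕ} (hk : 3 ≤ k) (hko : Odd k) {N : Fin k → ℕ}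
    (hN : ∀ c : Fin k, N c = (k - 3) / 2) {i j : ℕ} (hij : i < j) (hj : j < k) :
    ∑ y : Fin (N (chordClass (k := k) (by omega) i j)) × Bool × Bool,
      (targetSign (N := N) i j (.inl ⟨chordClass (by omega) i j, y⟩) : ℤ) =
        2 * (j - i) - k + if Odd (i + j) then 1 else -1 := by
  have hk0 : 0 < k := by omega
  have hc := chordClass_eq_or hk0 (hij.trans hj) hj
  generalize chordClass _ i j = c at *
  have hck := c.2
  have hNc := hN c
  obtain ⟨h, rfl⟩ := hko
  simp only [Nat.odd_iff]
  by_cases ho : Odd (c : ℕ)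
  · have ho' := Nat.odd_iff.1 ho
    have hg : ∀ u, gap c u = 2 * u + 2 + 0 := fun u => by simp [gap, ho]
    rcases hc with hc | hc
    · rw [sum_cluster_self hk0 (t := (j - i) / 2) hg (by omega) (Or.inl ⟨hc, by omega⟩), if_pos hc]
      split_ifs <;> omega
    · rw [sum_cluster_self hk0 (t := (i + (2 * h + 1) - j) / 2) hg (by omega)
        (Or.inr ⟨hc, by omega⟩), if_neg (by omega)]
      split_ifs <;> omega
  · have ho' := Nat.not_odd_iff.1 ho
    have hg : ∀ u, gap c u = 2 * u + 2 + 1 := fun u => by simp [gap, ho]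
    rcases hc with hc | hc
    · rw [sum_cluster_self hk0 (t := (j - i) / 2 - 1) hg (by omega) (Or.inl ⟨hc, by omega⟩),
        if_pos hc]
      split_ifs <;> omega
    · rw [sum_cluster_self hk0 (t := (i + (2 * h + 1) - j) / 2 - 1) hg (by omega)
        (Or.inr ⟨hc, by omega⟩), if_neg (by omega)]
      split_ifs <;> omega

theorem sum_alternating (k : ℕ) :
    ∑ l ∈ Finset.range k, (-1 : ℤ) ^ l = if Odd k then 1 else 0 := by
  induction k with
  | zero => simp
  | succ k ih =>
    rw [Finset.sum_range_succ, ih]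
    by_cases h : Odd k
    · rw [if_pos h, if_neg (by simpa [Nat.odd_add_one] using h), h.neg_one_pow]; rfl
    · rw [if_neg h, if_pos (by simpa [Nat.odd_add_one] using h),
        (Nat.not_odd_iff_even.1 h).neg_one_pow]; rfl

/-- The sum is twice the partial sum up to `c` minus the total, which is 1 because `k` is odd. -/
theorem sum_alternating_switch {k c : ℕ} (hc : c < k) (hk : Odd k) :
    ∑ l ∈ Finset.range k, (-1 : ℤ) ^ l * (if l ≤ c then 1 else -1) = if Odd c then -1 else 1 := by
  have h1 : ∀ l ∈ Finset.range k, (-1 : ℤ) ^ l * (if l ≤ c then 1 else -1) =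
      2 * (if l < c + 1 then (-1 : ℤ) ^ l else 0) - (-1) ^ l := by
    intro l _
    by_cases h : l ≤ c
    · rw [if_pos h, if_pos (by omega)]; ring
    · rw [if_neg h, if_neg (by omega)]; ring
  have h2 : (Finset.range k).filter (fun l => l < c + 1) = Finset.range (c + 1) := by
    ext l
    simp only [Finset.mem_filter, Finset.mem_range]
    omega
  rw [Finset.sum_congr rfl h1, Finset.sum_sub_distrib, ← Finset.mul_sum, ← Finset.sum_filter, h2,
    sum_alternating, sum_alternating, if_pos hk]
  by_cases h : Odd c
  · rw [if_pos h, if_neg (by simpa [Nat.odd_add_one] using h)]; rfl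
  · rw [if_neg h, if_pos (by simpa [Nat.odd_add_one] using h)]; rfl

/-- The far points exactly cancel the error left by `sum_cluster_odd`. Since `k` is odd, subtracting
`k` from `i + j` changes the parity, in accordance with the reversed normal. -/
theorem sum_far {k : ℕ} (hko : Odd k) {N : Fin k → ℕ} {i j : ℕ} (hij : i < j) (hj : j < k) :
    ∑ l : Fin k, (targetSign (N := N) i j (.inr l) : ℤ) = -(if Odd (i + j) then 1 else -1) := by
  have hcoe : ∀ (l : ℕ) (p : Prop) [Decidable p],
      (((-1) ^ l * (if p then 1 else -1) : SignType) : ℤ) = (-1) ^ l * (if p then 1 else -1) := by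
    intro l p _
    rw [SignType.coe_mul, SignType.coe_pow]
    split_ifs <;> simp
  simp only [targetSign]
  by_cases h : i + j < k
  · simp only [if_pos h, hcoe]
    rw [Fin.sum_univ_eq_sum_range (fun l => (-1 : ℤ) ^ l * (if l ≤ i + j then 1 else -1)),
      sum_alternating_switch h hko]
    split_ifs <;> rfl
  · simp only [if_neg h, SignType.coe_neg, hcoe]
    rw [Finset.sum_neg_distrib,
      Fin.sum_univ_eq_sum_range (fun l => (-1 : ℤ) ^ l * (if l ≤ i + j - k then 1 else -1)),
      sum_alternating_switch (by omega) hko]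
    have h1 : Odd (i + j - k) ↔ ¬ Odd (i + j) := by
      rw [Nat.odd_iff] at *
      rw [Nat.odd_iff]
      omega
    simp only [h1]
    split_ifs <;> rfl

/-! ### Assembling the configurations -/

theorem signSum_vertexSet {k : ℕ} {P : Fin k → ℝ × ℝ} (hP : Function.Injective P)
    (hs : ∀ i j l : Fin k, i < j → SignType.sign (orient (P i) (P j) (P l)) =
      SignType.sign ((l : ℤ) - i) * SignType.sign ((l : ℤ) - j)) {i j : Fin k} (hij : i < j) :
    signSum (vertexSet P) (P i) (P j) = k - 2 * ((j : ℕ) - (i : ℕ)) := by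
  rw [vertexSet, signSum_image hP, ← sum_vertex_sign hij j.2]
  exact Finset.sum_congr rfl fun l _ => by rw [hs i j l hij]

theorem card_vertexSet {k : ℕ} {P : Fin k → ℝ × ℝ} (hP : Function.Injective P) :
    (vertexSet P).card = k := by
  rw [vertexSet, Finset.card_image_of_injective _ hP, Finset.card_univ, Fintype.card_fin]

theorem forall_ne_of_forall_lt {k : ℕ} {p : Fin k → Fin k → Prop} (hp : ∀ i j, p i j → p j i)
    (h : ∀ i j, i < j → p i j) (i j : Fin k) (hij : i ≠ j) : p i j := by
  rcases lt_or_gt_of_ne hij with h1 | h1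
  · exact h i j h1
  · exact hp j i (h j i h1)

theorem inClass_iff {k : ℕ} (hk : 0 < k) (c i j : Fin k) :
    InClass c i j ↔ c = chordClass hk i j := by
  rw [InClass, chordClass, Fin.ext_iff, eq_comm]

theorem sum_range_parity (h a b : ℕ) :
    ∑ c ∈ Finset.range (2 * h), (if Odd c then a else b) = h * (a + b) := by
  induction h with
  | zero => simp
  | succ h ih =>
    rw [mul_add, mul_one, Finset.sum_range_succ, Finset.sum_range_succ, ih,
      if_neg (by simp [parity_simps]), if_pos (by simp [parity_simps])]
    ring

open Classical in
theorem exists_even_configuration {k : ℕ} (hke : Even k) (hk : 4 ≤ k) :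
    ∃ P : Fin k → ℝ × ℝ, IsDistortedRegularPolygon k P ∧ Function.Injective P ∧
      ∃ Q : Fin k → Finset (ℝ × ℝ),
        (∀ c d : Fin k, c ≠ d → Disjoint (Q c) (Q d)) ∧
        (∀ c : Fin k, Disjoint (vertexSet P) (Q c)) ∧
        (∀ c : Fin k, (Q c).card = if Odd (c : ℕ) then 2 * k - 4 else 2 * k - 8) ∧
        (addedPoints Q).card = 2 * k ^ 2 - 6 * k ∧
        GeneralPosition (vertexSet P ∪ addedPoints Q) ∧
        (∀ c i j : Fin k, i ≠ j → InClass c i j → Bisects (vertexSet P ∪ Q c) (P i) (P j)) ∧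
        (∀ c i j : Fin k, i ≠ j → ¬ InClass c i j → Bisects (Q c) (P i) (P j)) ∧
        (∀ i j : Fin k, i ≠ j →
          IsHalvingLine (vertexSet P ∪ addedPoints Q) (P i) (P j)) := by
  have hk0 : 0 < k := by omega
  set N : Fin k → ℕ := fun c => if Odd (c : ℕ) then k / 2 - 1 else k / 2 - 2 with hN
  obtain ⟨P, hPd, hPi, hPs, z, hzi, hzP, hgp, hz⟩ := exists_configuration (N := N)
    (by omega : 3 ≤ k) (by
      intro c u hu
      simp only [hN] at hu
      unfold gap
      split_ifs at hu ⊢ <;> omega)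
  have hzc : ∀ c, Function.Injective fun y => z (.inl ⟨c, y⟩) := by
    intro c y y' h
    have := hzi h
    simpa using this
  set Q : Fin k → Finset (ℝ × ℝ) := fun c => Finset.univ.image fun y => z (.inl ⟨c, y⟩) with hQ
  have hQd : ∀ c d : Fin k, c ≠ d → Disjoint (Q c) (Q d) := by
    intro c d hcd
    rw [Finset.disjoint_left]
    intro p hp hp'
    obtain ⟨y, -, rfl⟩ := Finset.mem_image.1 hp
    obtain ⟨y', -, h⟩ := Finset.mem_image.1 hp'
    have := hzi h
    simp only [Sum.inl.injEq, Sigma.mk.injEq] at this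
    exact hcd this.1.symm
  have hPQ : ∀ c : Fin k, Disjoint (vertexSet P) (Q c) := by
    intro c
    rw [Finset.disjoint_right]
    intro p hp
    obtain ⟨y, -, rfl⟩ := Finset.mem_image.1 hp
    exact hzP _
  have hcard : ∀ c : Fin k, (Q c).card = if Odd (c : ℕ) then 2 * k - 4 else 2 * k - 8 := by
    intro c
    rw [hQ, Finset.card_image_of_injective _ (hzc c)]
    simp only [Finset.card_univ, Fintype.card_prod, Fintype.card_fin, Fintype.card_bool, hN]
    obtain ⟨h, rfl⟩ := hke
    split_ifs <;> omega
  have hsumQ : ∀ c i j : Fin k, i < j → signSum (Q c) (P i) (P j) =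
      ∑ y : Fin (N c) × Bool × Bool, (targetSign (N := N) (i : ℕ) (j : ℕ) (.inl ⟨c, y⟩) : ℤ) := by
    intro c i j hij
    rw [hQ, signSum_image (hzc c)]
    exact Finset.sum_congr rfl fun y _ => by rw [hz _ i j hij]
  have hself : ∀ i j : Fin k, i < j →
      signSum (Q (chordClass hk0 i j)) (P i) (P j) = 2 * ((j : ℕ) - (i : ℕ)) - k := by
    intro i j hij
    rw [hsumQ _ i j hij]
    exact sum_cluster_even hk0 hke (fun _ => rfl) hij j.2
  have hother : ∀ c i j : Fin k, i < j → c ≠ chordClass hk0 i j →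
      signSum (Q c) (P i) (P j) = 0 := fun c i j hij hc => by
    rw [hsumQ _ i j hij, sum_cluster_of_ne hk0 hc]
  have hclass : ∀ i j : Fin k, chordClass hk0 (i : ℕ) (j : ℕ) = chordClass hk0 (j : ℕ) (i : ℕ) :=
    fun i j => by simp only [chordClass, add_comm]
  have hdisj : Disjoint (vertexSet P) (addedPoints Q) := by
    rw [addedPoints, Finset.disjoint_biUnion_right]
    exact fun c _ => hPQ c
  refine ⟨P, hPd, hPi, Q, hQd, hPQ, hcard, ?_, hgp.mono ?_, ?_, ?_, ?_⟩
  · rw [addedPoints, Finset.card_biUnion fun c _ d _ h => hQd c d h,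
      Finset.sum_congr rfl fun c _ => hcard c,
      Fin.sum_univ_eq_sum_range (fun c => if Odd c then 2 * k - 4 else 2 * k - 8)]
    obtain ⟨h, rfl⟩ := hke
    rw [← two_mul, sum_range_parity]
    -- Writing `k = 2 * (2 + m)` removes the truncated subtractions.
    obtain ⟨m, rfl⟩ := Nat.exists_eq_add_of_le (by omega : 2 ≤ h)
    have h1 : 2 * (2 * (2 + m)) - 4 = 4 + 4 * m := by omega
    have h2 : 2 * (2 * (2 + m)) - 8 = 4 * m := by omega
    rw [h1, h2]
    refine (Nat.sub_eq_of_eq_add ?_).symm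
    ring
  · refine Finset.union_subset_union_right ?_
    intro p hp
    obtain ⟨c, -, hp⟩ := Finset.mem_biUnion.1 hp
    obtain ⟨y, -, rfl⟩ := Finset.mem_image.1 hp
    exact Finset.mem_image_of_mem _ (Finset.mem_univ _)
  · intro c i j hij hc
    rw [inClass_iff hk0] at hc
    subst hc
    revert i j
    refine forall_ne_of_forall_lt (fun i j h => by rw [hclass]; exact h.symm) fun i j hij => ?_
    rw [bisects_iff_signSum, signSum_union (hPQ _), signSum_vertexSet hPi hPs hij, hself i j hij]
    ring
  · intro c i j hij
    rw [inClass_iff hk0]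
    revert i j
    refine forall_ne_of_forall_lt (fun i j h hc => (h (by rwa [hclass])).symm) fun i j hij hc => ?_
    rw [bisects_iff_signSum]
    exact hother c i j hij hc
  · refine fun i j hij => ⟨Finset.mem_union_left _ (Finset.mem_image_of_mem _ (Finset.mem_univ _)),
      Finset.mem_union_left _ (Finset.mem_image_of_mem _ (Finset.mem_univ _)), hPi.ne hij, ?_⟩
    revert i j
    refine forall_ne_of_forall_lt (fun i j h => h.symm) fun i j hij => ?_
    have h1 : signSum (addedPoints Q) (P i) (P j) = ∑ c, signSum (Q c) (P i) (P j) :=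
      Finset.sum_biUnion fun c _ d _ h => hQd c d h
    rw [bisects_iff_signSum, signSum_union hdisj, signSum_vertexSet hPi hPs hij, h1,
      Finset.sum_eq_single (chordClass hk0 i j) (fun c _ hc => hother c i j hij hc) (by simp),
      hself i j hij]
    ring

theorem hasHalvingClique_of_even {k : ℕ} (hke : Even k) (hk : 4 ≤ k) :
    HasHalvingClique (2 * k ^ 2 - 5 * k) k := by
  classical
  obtain ⟨P, -, hPi, Q, -, hPQ, -, hcard, hgp, -, -, hh⟩ := exists_even_configuration hke hk
  have hdisj : Disjoint (vertexSet P) (addedPoints Q) := by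
    rw [addedPoints, Finset.disjoint_biUnion_right]
    exact fun c _ => hPQ c
  refine ⟨_, vertexSet P, Finset.subset_union_left, ?_, card_vertexSet hPi, hgp, ?_⟩
  · rw [Finset.card_union_of_disjoint hdisj, hcard, card_vertexSet hPi]
    have : 6 * k ≤ 2 * k ^ 2 := by nlinarith
    omega
  · simp only [vertexSet, Finset.mem_image, Finset.mem_univ, true_and]
    rintro _ ⟨i, rfl⟩ _ ⟨j, rfl⟩ hij
    exact (hh i j fun h => hij (h ▸ rfl)).2.2.2

/-- The total is `k` vertices, `4 * ((k - 3) / 2)` points in each of `k` clusters and `k` far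
points. -/
theorem hasHalvingClique_of_odd {k : ℕ} (hko : Odd k) (hk : 3 ≤ k) :
    HasHalvingClique (2 * k ^ 2 - 4 * k) k := by
  classical
  have hk0 : 0 < k := by omega
  set N : Fin k → ℕ := fun _ => (k - 3) / 2 with hN
  obtain ⟨P, -, hPi, hPs, z, hzi, hzP, hgp, hz⟩ := exists_configuration
    (N := N) hk (by
      intro c u hu
      simp only [hN] at hu
      unfold gap
      split_ifs <;> omega)
  have hdisj : Disjoint (vertexSet P) (Finset.univ.image z) := by
    rw [Finset.disjoint_right]
    intro p hp
    obtain ⟨y, -, rfl⟩ := Finset.mem_image.1 hp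
    exact hzP _
  refine ⟨_, vertexSet P, Finset.subset_union_left, ?_, card_vertexSet hPi, hgp, ?_⟩
  · rw [Finset.card_union_of_disjoint hdisj, card_vertexSet hPi,
      Finset.card_image_of_injective _ hzi]
    simp only [Finset.card_univ, Fintype.card_sum, Fintype.card_sigma, Fintype.card_prod,
      Fintype.card_fin, Fintype.card_bool, Finset.sum_const, smul_eq_mul, hN]
    obtain ⟨h, rfl⟩ := hko
    obtain ⟨m, rfl⟩ := Nat.exists_eq_add_of_le (by omega : 1 ≤ h)
    have h1 : (2 * (1 + m) + 1 - 3) / 2 = m := by omega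
    rw [h1]
    refine (Nat.sub_eq_of_eq_add ?_).symm
    ring
  · simp only [vertexSet, Finset.mem_image, Finset.mem_univ, true_and]
    rintro _ ⟨i, rfl⟩ _ ⟨j, rfl⟩ hij
    have hij' : i ≠ j := fun h => hij (h ▸ rfl)
    clear hij
    revert i j
    refine forall_ne_of_forall_lt (fun i j h => h.symm) fun i j hij => ?_
    have h1 := signSum_vertexSet hPi hPs hij
    rw [vertexSet] at h1 hdisj
    rw [bisects_iff_signSum, signSum_union hdisj, h1, signSum_image hzi]
    simp only [hz _ i j hij]
    have h2 : ∑ c, ∑ y : Fin (N c) × Bool × Bool,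
        (targetSign (N := N) (i : ℕ) (j : ℕ) (.inl ⟨c, y⟩) : ℤ) = _ :=
      Finset.sum_eq_single (chordClass hk0 i j) (fun c _ hc => sum_cluster_of_ne hk0 hc) (by simp)
    rw [sum_cluster_odd hk hko (fun _ => rfl) hij j.2] at h2
    rw [Fintype.sum_sum_type, Fintype.sum_sigma, sum_far hko hij j.2, h2]
    ring

/-! ### Cliques of the required size for every even number of points -/

theorem hasHalvingClique_two : HasHalvingClique 2 2 := by
  classical
  have hne : ((0, 0) : ℝ × ℝ) ≠ (1, 0) := by simp
  refine ⟨{(0, 0), (1, 0)}, {(0, 0), (1, 0)}, subset_rfl, Finset.card_pair hne,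
    Finset.card_pair hne, ?_, ?_⟩
  · intro p hp q hq r hr hpq hpr hqr
    simp only [Finset.mem_insert, Finset.mem_singleton] at hp hq hr
    rcases hp with rfl | rfl <;> rcases hq with rfl | rfl <;> rcases hr with rfl | rfl <;> simp_all
  · intro p hp q hq hpq
    rw [bisects_iff_signSum, signSum, Finset.sum_pair hne]
    simp only [Finset.mem_insert, Finset.mem_singleton] at hp hq
    rcases hp with rfl | rfl <;> rcases hq with rfl | rfl <;> simp [orient]

theorem HasHalvingClique.mono {n n' m : ℕ} (h : HasHalvingClique n m) (hn : Even n)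
    (hn' : Even n') (hle : n ≤ n') : HasHalvingClique n' m := by
  obtain ⟨a, rfl⟩ := Nat.exists_eq_add_of_le hle
  obtain ⟨b, rfl⟩ := (Nat.even_add.1 hn').1 hn
  rw [← two_mul]
  exact h.add_two_mul b

/-- Both `2k² - 5k` and `2k² - 4k` are at most `2(k - 1)²`, so the configuration for either parity
can be padded to `n` points; `k = 2` needs a separate start. -/
theorem hasHalvingClique {n k : ℕ} (hn : Even n) (hk : 2 ≤ k) (hnk : 2 * (k - 1) ^ 2 ≤ n) :
    HasHalvingClique n k := by
  obtain ⟨m, rfl⟩ := Nat.exists_eq_add_of_le hk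
  have h1 : 2 + m - 1 = 1 + m := by omega
  rw [h1] at hnk
  rcases Nat.even_or_odd (2 + m) with he | ho
  · rcases Nat.eq_zero_or_pos m with rfl | hm
    · exact hasHalvingClique_two.mono even_two hn (by simpa using hnk)
    · have hm2 : 2 ≤ m := by
        obtain ⟨h, hh⟩ := he
        omega
      refine (hasHalvingClique_of_even he (by omega)).mono ?_ hn ?_
      · obtain ⟨h, hh⟩ := he
        exact ⟨(2 + m) ^ 2 - 5 * h, by omega⟩
      · rw [Nat.sub_le_iff_le_add]
        nlinarith
  · refine (hasHalvingClique_of_odd ho (by obtain ⟨h, hh⟩ := ho; omega)).mono ?_ hn ?_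
    · exact ⟨(2 + m) ^ 2 - 2 * (2 + m), by omega⟩
    · rw [Nat.sub_le_iff_le_add]
      nlinarith

theorem exists_clique_card_ge {n : ℕ} (hn : Even n) :
    ∃ S : Finset (ℝ × ℝ), S.card = n ∧ GeneralPosition S ∧
      ∃ K : Finset S, (underlyingGraph S).IsClique (K : Set S) ∧
        √((n : ℝ) / 2) ≤ (K.card : ℝ) := by
  classical
  rcases Nat.eq_zero_or_pos n with rfl | hpos
  · exact ⟨∅, rfl, by simp [GeneralPosition], ∅, by simp, by simp⟩
  -- The least such `k` satisfies `√(n / 2) ≤ k`. Minimality gives `2(k - 1)² < n` unless `k = 2`,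
  -- where `n ≥ 2` follows from `n` being even and positive.
  have hex : ∃ k, 2 ≤ k ∧ n ≤ 2 * k ^ 2 := ⟨n + 2, by omega, by nlinarith⟩
  obtain ⟨hk2, hnk⟩ := Nat.find_spec hex
  have hmin := fun m => Nat.find_min (m := m) hex
  generalize Nat.find hex = k at *
  obtain ⟨S, K, hKS, hS, hK, hgp, hb⟩ := hasHalvingClique hn hk2 (by
    rcases Nat.lt_or_ge 2 k with h | h
    · have := hmin (k - 1) (by omega)
      push Not at this
      exact (this (by omega)).le
    · have : k = 2 := by omega
      subst this
      obtain ⟨m, rfl⟩ := hn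
      omega)
  refine ⟨S, hS, hgp, K.subtype (· ∈ S), ?_, ?_⟩
  · intro p hp q hq hpq
    rw [Finset.mem_coe, Finset.mem_subtype] at hp hq
    exact ⟨p.2, q.2, fun h => hpq (Subtype.ext h), hb p hp q hq fun h => hpq (Subtype.ext h)⟩
  · rw [Finset.card_subtype, Finset.filter_true_of_mem fun p hp => hKS hp, hK]
    refine Real.sqrt_le_iff.2 ⟨Nat.cast_nonneg _, ?_⟩
    rw [div_le_iff₀ two_pos]
    have : (n : ℝ) ≤ 2 * (k : ℝ) ^ 2 := by exact_mod_cast hnk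
    linarith

end HalvingLines

open Classical in
theorem mainTheorem5 :
    (∀ n : ℕ, Even n →
      ∃ S : Finset (ℝ × ℝ), S.card = n ∧ HalvingLines.GeneralPosition S ∧
        ∃ K : Finset S, (HalvingLines.underlyingGraph S).IsClique (K : Set S) ∧
          √((n : ℝ) / 2) ≤ (K.card : ℝ)) ∧
    (∀ k : ℕ, Even k → 4 ≤ k →
      ∃ P : Fin k → ℝ × ℝ, HalvingLines.IsDistortedRegularPolygon k P ∧
        Function.Injective P ∧
        ∃ Q : Fin k → Finset (ℝ × ℝ),
          (∀ c d : Fin k, c ≠ d → Disjoint (Q c) (Q d)) ∧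
          (∀ c : Fin k, Disjoint (HalvingLines.vertexSet P) (Q c)) ∧
          (∀ c : Fin k, (Q c).card = if Odd (c : ℕ) then 2 * k - 4 else 2 * k - 8) ∧
          (HalvingLines.addedPoints Q).card = 2 * k ^ 2 - 6 * k ∧
          HalvingLines.GeneralPosition
            (HalvingLines.vertexSet P ∪ HalvingLines.addedPoints Q) ∧
          (∀ c i j : Fin k, i ≠ j → HalvingLines.InClass c i j →
            HalvingLines.Bisects (HalvingLines.vertexSet P ∪ Q c) (P i) (P j)) ∧
          (∀ c i j : Fin k, i ≠ j → ¬ HalvingLines.InClass c i j →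
            HalvingLines.Bisects (Q c) (P i) (P j)) ∧
          (∀ i j : Fin k, i ≠ j →
            HalvingLines.IsHalvingLine
              (HalvingLines.vertexSet P ∪ HalvingLines.addedPoints Q) (P i) (P j))) := by
  exact ⟨fun _ hn => HalvingLines.exists_clique_card_ge hn,
    fun _ hke hk => HalvingLines.exists_even_configuration hke hk⟩
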